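/- Let $\lambda>0$ and let $G$ be a probability distribution on $[0,\infty)$. Let $I_1,I_2,\dots$ be exponentially distributed with mean $1/\lambda$ and $S_1,S_2,\dots$ distributed according to $G$, all these random variables being independent; put $T_0=0$ and $T_n=I_1+\dots+I_n$. For $x\in[0,1]$ let $V^x=(V^x_t)_{t\ge 0}$ be the workload process of the M/G/1 queue with capacity $1$ and truncated service (Model 1): $V^x_0=x$, and for $n\ge 1$ $$V^x_t=\max\bigl[V^x_{T_{n-1}}-(t-T_{n-1}),0\bigr]\quad (T_{n-1}\le t<T_n),\qquad V^x_{T_n}=\min\bigl[V^x_{T_n-}+S_n,\,1\bigr].$$ A probability measure $\pi$ on $[0,1]$ is called invariant (stationary) if $\int \mathbb P(V^x_t\in A)\,\pi(dx)=\pi(A)$ for all $t\ge 0$ and all Borel sets $A$. Let $\bar G(x)=1-G(x)=G((x,\infty))$ for $x\ge 0$, and let $\bar G^{*i}$ be its convolution powers on the half line: $\bar G^{*1}=\bar G$ and $\bar G^{*(i+1)}(x)=\int_0^x\bar G(x-y)\,\bar G^{*i}(y)\,dy$. **Theorem 1.** There is exactly one invariant distribution $\pi$. The series $\sum_{i\ge1}\lambda^i\bar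 G^{*i}(x)$ and $\sum_{i\ge1}\lambda^i\int_0^x\bar G^{*i}(y)\,dy$ converge for all $x\in[0,1]$. On $(0,1]$ the distribution $\pi$ has the density (with respect to Lebesgue measure) $$\bar\pi(x)=\frac{1}{1+\sum_{i=1}^\infty\lambda^i\int_0^1\bar G^{*i}(y)\,dy}\;\sum_{i=1}^\infty\lambda^i\,\bar G^{*i}(x),$$ and its distribution function $\pi(x)=\pi([0,x])$ is $$\pi(x)=\frac{1+\sum_{i=1}^\infty\lambda^i\int_0^x\bar G^{*i}(y)\,dy}{1+\sum_{i=1}^\infty\lambda^i\int_0^1\bar G^{*i}(y)\,dy},\qquad 0\le x\le 1.$$ In particular $\pi$ has an atom at $0$ of mass $\pi(\{0\})=\bigl(1+\sum_{i\ge1}\lambda^i\int_0^1\bar G^{*i}(y)\,dy\bigr)^{-1}>0$. -/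

import Mathlib

namespace TruncatedQueue

open MeasureTheory ProbabilityTheory Set

noncomputable section

/-- The random input of the M/G/1 queue with arrival rate `lam` and service distribution `G`:
`I n` is the time between the `n`-th and the `(n+1)`-st arrival (the `0`-th "arrival" being time
`0`), and `S n` is the service requirement of the `(n+1)`-st customer. -/
structure IsInput {Ω : Type*} [MeasurableSpace Ω] (P : Measure Ω) (lam : ℝ) (G : Measure ℝ)
    (I S : ℕ → Ω → ℝ) : Prop where
  measurable_I : ∀ n, Measurable (I n)
  measurable_S : ∀ n, Measurable (S n)
  law_I : ∀ n, P.map (I n) = expMeasure lam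
  law_S : ∀ n, P.map (S n) = G
  /-- All the variables `I 0, I 1, …, S 0, S 1, …` together are mutually independent. -/
  indep : iIndepFun (Sum.elim I S) P

/-- The arrival times `T₀ = 0`, `Tₙ = I₁ + ⋯ + Iₙ` along one path `i` of inter-arrival times. -/
def arrivalTime (i : ℕ → ℝ) (n : ℕ) : ℝ := ∑ k ∈ Finset.range n, i k

/-- The workload right at time `Tₙ`, started in `x`. Between arrivals it decreases at rate one
until it reaches `0`; an arrival adds its service requirement, truncated at the capacity `1`. -/
def workloadAtArrival (i s : ℕ → ℝ) (x : ℝ) : ℕ → ℝ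
  | 0 => x
  | n + 1 => min (max (workloadAtArrival i s x n - i n) 0 + s n) 1

/-- The number of arrivals in `(0, t]`, i.e. the `n` with `Tₙ ≤ t < Tₙ₊₁`
(almost surely `T₀ < T₁ < ⋯` tends to infinity, so that this `n` exists). -/
def arrivalCount (i : ℕ → ℝ) (t : ℝ) : ℕ := sSup {n : ℕ | arrivalTime i n ≤ t}

/-- The workload at time `t ≥ 0` of the queue with truncated service, started in `x`. -/
def workload (i s : ℕ → ℝ) (x t : ℝ) : ℝ :=
  max (workloadAtArrival i s x (arrivalCount i t) - (t - arrivalTime i (arrivalCount i t))) 0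

/-- The law of the workload at time `t` when it starts in `x`: `A ↦ ℙ(Vₜˣ ∈ A)`. -/
def transition {Ω : Type*} [MeasurableSpace Ω] (P : Measure Ω) (I S : ℕ → Ω → ℝ)
    (t x : ℝ) (A : Set ℝ) : ENNReal :=
  P {ω | workload (fun n => I n ω) (fun n => S n ω) x t ∈ A}

/-- `π` is an invariant (stationary) probability distribution, on the state space `[0, 1]`, of the
workload process. -/
structure IsInvariantDistribution {Ω : Type*} [MeasurableSpace Ω] (P : Measure Ω)
    (I S : ℕ → Ω → ℝ) (π : Measure ℝ) : Prop where
  isProbabilityMeasure : IsProbabilityMeasure π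
  supported : π (Icc 0 1)ᶜ = 0
  invariant : ∀ t : ℝ, 0 ≤ t → ∀ A : Set ℝ, MeasurableSet A →
    ∫⁻ x, transition P I S t x A ∂π = π A

/-- The tail `Ḡ(x) = 1 - G(x) = G((x, ∞))` of the distribution `G`. -/
def tail (G : Measure ℝ) (x : ℝ) : ℝ := 1 - cdf G x

/-- Convolution powers on the half line: `convPow f n` is `f^{*(n+1)}`, where
`(f * g)(x) = ∫₀ˣ f(x - y) g(y) dy`. -/
def convPow (f : ℝ → ℝ) : ℕ → ℝ → ℝ
  | 0 => f
  | n + 1 => fun x => ∫ y in (0 : ℝ)..x, f (x - y) * convPow f n y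

/-- `∑_{i ≥ 1} λⁱ Ḡ^{*i}(x)`. -/
def densitySeries (lam : ℝ) (G : Measure ℝ) (x : ℝ) : ℝ :=
  ∑' n : ℕ, lam ^ (n + 1) * convPow (tail G) n x

/-- `∑_{i ≥ 1} λⁱ ∫₀ˣ Ḡ^{*i}(y) dy`. -/
def integralSeries (lam : ℝ) (G : Measure ℝ) (x : ℝ) : ℝ :=
  ∑' n : ℕ, lam ^ (n + 1) * ∫ y in (0 : ℝ)..x, convPow (tail G) n y

end

end TruncatedQueue

namespace TruncatedQueue

open MeasureTheory ProbabilityTheory Set Filter Topology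
open scoped ENNReal Interval

/-! ### Convolution powers of a bounded function and their generating series -/

/-! Write `u` for the density series. Since the tail `Ḡ` is bounded by `1`, its convolution powers
decay factorially, so `u` converges for every `λ` and solves the renewal equation `u = λ Ḡ + λ Ḡ *
u` (`densitySeries_eq`).

Existence. Let `ν` be the unit atom at `0` plus `u dx` on `(0, 1]`, `H` its distribution function,
and `M` the law obtained from `ν` by one truncated arrival. Below the capacity the renewal equation
says `u = λ (H - H * G)`, that is `M(Iic w) = H(w) - u(w) / λ`; with `u` set to `0` from `1` on,
this holds for all `w ≥ 0` (`arrivalMeasure_Iic`). Integrating `e^{-λw} (λ H - u) = -(e^{-λw} H)'`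
over `[x, x + t]` gives the balance equation `stationaryMeasure_balance`: `ν` is recovered by
looking back over a window of length `t`, in which either no arrival occurred or the last one was an
exponential time ago and left the law `M`. The transition probabilities satisfy the mirror equation,
a decomposition at the first arrival (`IsInput.transition_eq`). Computing `λ ∫₀ᵗ ν k_s ds`, with `k`
the transition function just before the service is added, once by each equation yields invariance
(`lintegral_eq_of_renewal_of_balance`), without generators or time derivatives.

Uniqueness. An inter-arrival gap of length at least `1` empties the queue from any start in `[0,
1]`, and such gaps occur almost surely. Paths driven by the same input therefore coalesce, and two
invariant laws agree on every set up to `ε`. -/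

theorem measurable_intervalIntegral_convolution {f g : ℝ → ℝ} (hf : Measurable f)
    (hg : Measurable g) : Measurable fun x : ℝ => ∫ y in (0 : ℝ)..x, f (x - y) * g y := by
  -- The oriented integral is a difference of two full-line integrals, one for each sign of `x`,
  -- with the moving endpoint absorbed into an indicator on the plane.
  have key : ∀ s : Set (ℝ × ℝ), MeasurableSet s → Measurable fun x : ℝ =>
      ∫ y, s.indicator (fun p : ℝ × ℝ => f (p.1 - p.2) * g p.2) (x, y) := by
    intro s hs
    have hm : Measurable (s.indicator (fun p : ℝ × ℝ => f (p.1 - p.2) * g p.2)) :=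
      Measurable.indicator (by fun_prop) hs
    exact (hm.stronglyMeasurable.integral_prod_right' (ν := volume)).measurable
  have h1 := key {p | 0 < p.2 ∧ p.2 ≤ p.1}
    ((measurableSet_lt measurable_const measurable_snd).inter
      (measurableSet_le measurable_snd measurable_fst))
  have h2 := key {p | p.1 < p.2 ∧ p.2 ≤ 0}
    ((measurableSet_lt measurable_fst measurable_snd).inter
      (measurableSet_le measurable_snd measurable_const))
  convert! h1.sub h2 using 2 with x
  rw [intervalIntegral, ← integral_indicator measurableSet_Ioc,
    ← integral_indicator measurableSet_Ioc]
  rfl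

theorem measurable_convPow {f : ℝ → ℝ} (hf : Measurable f) (n : ℕ) : Measurable (convPow f n) := by
  induction n with
  | zero => exact hf
  | succ n ih => exact measurable_intervalIntegral_convolution hf ih

/-- Convolving with a function bounded by `1` costs at most one integration of `|y|ⁿ / n!`. The
factorial gives convergence for every `λ`, with no condition on the load. -/
theorem abs_convPow_le {f : ℝ → ℝ} (hf : ∀ x, |f x| ≤ 1) (n : ℕ) (x : ℝ) :
    |convPow f n x| ≤ |x| ^ n / n.factorial := by
  induction n generalizing x with
  | zero => simpa [convPow] using hf x
  | succ n ih =>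
    have hint : IntegrableOn (fun y : ℝ => |y| ^ n / n.factorial) (Ι 0 x) := by
      rw [← intervalIntegrable_iff]
      exact (by fun_prop : Continuous fun y : ℝ => |y| ^ n / n.factorial).intervalIntegrable _ _
    have h := intervalIntegral.norm_integral_le_integral_norm_uIoc
      (f := fun y => f (x - y) * convPow f n y) (a := 0) (b := x) (μ := volume)
    have h2 : ∫ y in Ι 0 x, ‖f (x - y) * convPow f n y‖ ≤ ∫ y in Ι 0 x, |y| ^ n / n.factorial := by
      refine integral_mono_of_nonneg (Eventually.of_forall fun y => norm_nonneg _) hint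
        (Eventually.of_forall fun y => ?_)
      simp only [norm_mul, Real.norm_eq_abs]
      calc _ ≤ 1 * |convPow f n y| := by gcongr; exact hf _
        _ ≤ _ := by rw [one_mul]; exact ih y
    have h3 : ∫ y in Ι 0 x, |y| ^ n / (n.factorial : ℝ) = |x| ^ (n + 1) / (n + 1).factorial := by
      have := integral_pow_abs_sub_uIoc (a := 0) (b := x) (n := n)
      simp only [sub_zero] at this
      rw [integral_div, this, div_div, Nat.factorial_succ]
      push_cast
      rfl
    exact h.trans (h2.trans h3.le)

theorem convPow_nonneg {f : ℝ → ℝ} (hf : ∀ x, 0 ≤ f x) (n : ℕ) {x : ℝ} (hx : 0 ≤ x) :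
    0 ≤ convPow f n x := by
  induction n generalizing x with
  | zero => exact hf x
  | succ n ih =>
    exact intervalIntegral.integral_nonneg hx fun y hy => mul_nonneg (hf _) (ih hy.1)

theorem norm_pow_mul_convPow_le {f : ℝ → ℝ} (hf : ∀ x, |f x| ≤ 1) {lam : ℝ} (hlam : 0 ≤ lam)
    (n : ℕ) {x b : ℝ} (hx : |x| ≤ b) :
    ‖lam ^ (n + 1) * convPow f n x‖ ≤ lam * ((lam * b) ^ n / n.factorial) := by
  rw [norm_mul, Real.norm_eq_abs, Real.norm_eq_abs, abs_of_nonneg (by positivity)]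
  calc _ ≤ lam ^ (n + 1) * (b ^ n / n.factorial) := by
        gcongr
        exact (abs_convPow_le hf n x).trans (by gcongr)
    _ = _ := by rw [mul_pow]; ring

theorem summable_mul_pow_div_factorial (lam b : ℝ) :
    Summable fun n : ℕ => lam * ((lam * b) ^ n / n.factorial) :=
  (Real.summable_pow_div_factorial _).mul_left lam

theorem summable_pow_mul_convPow {f : ℝ → ℝ} (hf : ∀ x, |f x| ≤ 1) {lam : ℝ} (hlam : 0 ≤ lam)
    (x : ℝ) : Summable fun n : ℕ => lam ^ (n + 1) * convPow f n x :=
  .of_norm_bounded (summable_mul_pow_div_factorial lam |x|)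
    fun n => norm_pow_mul_convPow_le hf hlam n le_rfl

theorem intervalIntegrable_of_bounded_on {g : ℝ → ℝ} (hg : Measurable g) {a b C : ℝ}
    (h : ∀ x ∈ Ι a b, ‖g x‖ ≤ C) : IntervalIntegrable g volume a b := by
  rw [intervalIntegrable_iff]
  refine Measure.integrableOn_of_bounded (M := C) (by simp [uIoc]) hg.aestronglyMeasurable ?_
  exact (ae_restrict_iff' measurableSet_uIoc).2 (Eventually.of_forall h)

theorem abs_le_of_mem_uIoc_zero {x y : ℝ} (hy : y ∈ Ι 0 x) : |y| ≤ |x| := by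
  rcases le_total 0 x with h | h
  · rw [uIoc_of_le h] at hy
    rw [abs_of_pos hy.1, abs_of_nonneg h]
    exact hy.2
  · rw [uIoc_of_ge h] at hy
    rw [abs_of_nonpos hy.2, abs_of_nonpos h]
    linarith [hy.1]

theorem intervalIntegrable_convPow {f : ℝ → ℝ} (hm : Measurable f) (hf : ∀ x, |f x| ≤ 1) (n : ℕ)
    (x : ℝ) : IntervalIntegrable (convPow f n) volume 0 x :=
  intervalIntegrable_of_bounded_on (measurable_convPow hm n) (C := |x| ^ n / n.factorial)
    fun y hy => (abs_convPow_le hf n y).trans <|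
      div_le_div_of_nonneg_right (pow_le_pow_left₀ (abs_nonneg y) (abs_le_of_mem_uIoc_zero hy) n)
        (by positivity)

/-- Termwise integration of `∑ λⁿ⁺¹ f^{*(n+1)}` against a bounded weight. -/
theorem hasSum_integral_mul_convPow {f : ℝ → ℝ} (hm : Measurable f) (hf : ∀ x, |f x| ≤ 1)
    {lam : ℝ} (hlam : 0 ≤ lam) {k : ℝ → ℝ} (hkm : Measurable k) (hk : ∀ x, |k x| ≤ 1) (x : ℝ) :
    HasSum (fun n : ℕ => lam ^ (n + 1) * ∫ y in (0 : ℝ)..x, k y * convPow f n y)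
      (∫ y in (0 : ℝ)..x, k y * ∑' n : ℕ, lam ^ (n + 1) * convPow f n y) := by
  have h := intervalIntegral.hasSum_integral_of_dominated_convergence (μ := volume)
    (a := 0) (b := x) (F := fun (n : ℕ) y => k y * (lam ^ (n + 1) * convPow f n y))
    (f := fun y => k y * ∑' n : ℕ, lam ^ (n + 1) * convPow f n y)
    (fun n _ => lam * ((lam * |x|) ^ n / n.factorial))
    (fun n => (hkm.mul ((measurable_convPow hm n).const_mul _)).aestronglyMeasurable)
    (fun n => Eventually.of_forall fun y hy => by
      rw [norm_mul]
      calc _ ≤ 1 * ‖lam ^ (n + 1) * convPow f n y‖ := by gcongr; exact hk y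
        _ ≤ _ := by
          rw [one_mul]
          exact norm_pow_mul_convPow_le hf hlam n (abs_le_of_mem_uIoc_zero hy))
    (Eventually.of_forall fun _ _ => summable_mul_pow_div_factorial lam |x|)
    intervalIntegrable_const
    (Eventually.of_forall fun y _ => ((summable_pow_mul_convPow hf hlam y).hasSum).mul_left _)
  convert! h using 2 with n
  rw [← intervalIntegral.integral_const_mul]
  congr 1
  ext y
  ring

/-! ### The density series of the queue -/

theorem tail_nonneg (G : Measure ℝ) (x : ℝ) : 0 ≤ tail G x := sub_nonneg.2 (cdf_le_one G x)

theorem tail_le_one (G : Measure ℝ) (x : ℝ) : tail G x ≤ 1 := by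
  have := cdf_nonneg G x
  unfold tail
  linarith

theorem abs_tail_le_one (G : Measure ℝ) (x : ℝ) : |tail G x| ≤ 1 := by
  rw [abs_of_nonneg (tail_nonneg G x)]
  exact tail_le_one G x

theorem measurable_tail (G : Measure ℝ) : Measurable (tail G) :=
  measurable_const.sub (monotone_cdf G).measurable

theorem measurable_densitySeries {lam : ℝ} (hlam : 0 ≤ lam) (G : Measure ℝ) :
    Measurable (densitySeries lam G) :=
  measurable_of_tendsto_metrizable
    (f := fun (N : ℕ) x => ∑ n ∈ Finset.range N, lam ^ (n + 1) * convPow (tail G) n x)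
    (fun _ => Finset.measurable_fun_sum _ fun n _ =>
      (measurable_convPow (measurable_tail G) n).const_mul _)
    (tendsto_pi_nhds.2 fun x =>
      (summable_pow_mul_convPow (abs_tail_le_one G) hlam x).hasSum.tendsto_sum_nat)

theorem densitySeries_nonneg {lam : ℝ} (hlam : 0 ≤ lam) (G : Measure ℝ) {x : ℝ} (hx : 0 ≤ x) :
    0 ≤ densitySeries lam G x :=
  tsum_nonneg fun n => mul_nonneg (by positivity) (convPow_nonneg (tail_nonneg G) n hx)

theorem norm_densitySeries_le {lam : ℝ} (hlam : 0 ≤ lam) (G : Measure ℝ) {x b : ℝ} (hx : |x| ≤ b) :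
    ‖densitySeries lam G x‖ ≤ ∑' n : ℕ, lam * ((lam * b) ^ n / n.factorial) :=
  tsum_of_norm_bounded (summable_mul_pow_div_factorial lam b).hasSum
    fun n => norm_pow_mul_convPow_le (abs_tail_le_one G) hlam n hx

theorem hasSum_integralSeries {lam : ℝ} (hlam : 0 ≤ lam) (G : Measure ℝ) (x : ℝ) :
    HasSum (fun n : ℕ => lam ^ (n + 1) * ∫ y in (0 : ℝ)..x, convPow (tail G) n y)
      (∫ y in (0 : ℝ)..x, densitySeries lam G y) := by
  simpa using! hasSum_integral_mul_convPow (measurable_tail G) (abs_tail_le_one G) hlam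
    (k := fun _ => 1) measurable_const (by simp) x

theorem integralSeries_eq {lam : ℝ} (hlam : 0 ≤ lam) (G : Measure ℝ) (x : ℝ) :
    integralSeries lam G x = ∫ y in (0 : ℝ)..x, densitySeries lam G y :=
  (hasSum_integralSeries hlam G x).tsum_eq

/-- The renewal equation `u = λ Ḡ + λ Ḡ * u` for the density series. -/
theorem densitySeries_eq {lam : ℝ} (hlam : 0 ≤ lam) (G : Measure ℝ) (x : ℝ) :
    densitySeries lam G x =
      lam * tail G x + lam * ∫ y in (0 : ℝ)..x, tail G (x - y) * densitySeries lam G y := by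
  have h := hasSum_integral_mul_convPow (measurable_tail G) (abs_tail_le_one G) hlam
    (k := fun y => tail G (x - y)) ((measurable_tail G).comp (measurable_const.sub measurable_id))
    (fun y => abs_tail_le_one G _) x
  rw [densitySeries,
    (summable_pow_mul_convPow (abs_tail_le_one G) hlam x).tsum_eq_zero_add]
  congr 1
  · simp [convPow]
  · change _ = lam * ∫ y in (0 : ℝ)..x, tail G (x - y) *
      ∑' n : ℕ, lam ^ (n + 1) * convPow (tail G) n y
    rw [← h.tsum_eq, ← tsum_mul_left]
    congr 1
    ext n
    rw [pow_succ' lam (n + 1), mul_assoc]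
    rfl

/-- Integration by parts for `e^{-λw} (1 + ∫₀ʷ u)`. -/
theorem exp_mul_primitive_sub {u : ℝ → ℝ} (hu : ∀ a b, IntervalIntegrable u volume a b)
    (lam c x z : ℝ) :
    ∫ w in x..z, Real.exp (-(lam * w)) * (lam * (c + ∫ y in (0 : ℝ)..w, u y) - u w) =
      Real.exp (-(lam * x)) * (c + ∫ y in (0 : ℝ)..x, u y) -
        Real.exp (-(lam * z)) * (c + ∫ y in (0 : ℝ)..z, u y) := by
  set H : ℝ → ℝ := fun w => c + ∫ y in (0 : ℝ)..w, u y with hH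
  have hHx : H = fun w => (c + ∫ y in (0 : ℝ)..x, u y) + ∫ y in x..w, u y := by
    ext w
    rw [hH, add_assoc, intervalIntegral.integral_add_adjacent_intervals (hu _ _) (hu _ _)]
  -- As `u` is only integrable, `H` is differentiable merely almost everywhere; absolute continuity
  -- still permits integration by parts.
  have hHac : AbsolutelyContinuousOnInterval H x z := by
    rw [hHx]
    have hc : AbsolutelyContinuousOnInterval (fun _ : ℝ => c + ∫ y in (0 : ℝ)..x, u y) x z :=
      ContDiffOn.absolutelyContinuousOnInterval contDiffOn_const
    exact hc.add ((hu x z).absolutelyContinuousOnInterval_intervalIntegral (by simp))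
  have hE : AbsolutelyContinuousOnInterval (fun w => -Real.exp (-(lam * w))) x z :=
    ContDiffOn.absolutelyContinuousOnInterval (by fun_prop)
  have h := hE.integral_deriv_mul_eq_sub hHac
  rw [show Real.exp (-(lam * x)) * (c + ∫ y in (0 : ℝ)..x, u y) -
      Real.exp (-(lam * z)) * (c + ∫ y in (0 : ℝ)..z, u y) =
      -Real.exp (-(lam * z)) * H z - -Real.exp (-(lam * x)) * H x by simp only [hH]; ring, ← h]
  refine intervalIntegral.integral_congr_ae ?_
  filter_upwards [(hu x z).ae_hasDerivAt_integral] with w hw hwm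
  have hd : HasDerivAt H (u w) w := by
    rw [hHx]
    exact (hw (uIoc_subset_uIcc hwm) x (by simp)).const_add _
  rw [hd.deriv, hasDerivAt_neg_exp_mul_exp.deriv]
  ring

/-! ### Paths of the workload process -/

theorem arrivalTime_succ_eq (i : ℕ → ℝ) (n : ℕ) :
    arrivalTime i (n + 1) = i 0 + arrivalTime (fun k => i (k + 1)) n := by
  rw [arrivalTime, Finset.sum_range_succ', add_comm]
  rfl

/-- The definition recurses on the last arrival; the renewal argument needs the first one split off.
-/
theorem workloadAtArrival_succ_eq (i s : ℕ → ℝ) (x : ℝ) (n : ℕ) :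
    workloadAtArrival i s x (n + 1) = workloadAtArrival (fun k => i (k + 1)) (fun k => s (k + 1))
      (min (max (x - i 0) 0 + s 0) 1) n := by
  induction n with
  | zero => rfl
  | succ n ih => rw [workloadAtArrival, ih, workloadAtArrival]

theorem monotone_arrivalTime {i : ℕ → ℝ} (hi : ∀ n, 0 ≤ i n) : Monotone (arrivalTime i) :=
  monotone_nat_of_le_succ fun n => by
    simp only [arrivalTime, Finset.sum_range_succ]
    linarith [hi n]

theorem arrivalCount_eq {i : ℕ → ℝ} (hi : ∀ n, 0 ≤ i n) {t : ℝ} {n : ℕ}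
    (h1 : arrivalTime i n ≤ t) (h2 : t < arrivalTime i (n + 1)) : arrivalCount i t = n := by
  have : {k : ℕ | arrivalTime i k ≤ t} = Iic n := by
    ext k
    refine ⟨fun hk => ?_, fun hk => (monotone_arrivalTime hi hk).trans h1⟩
    by_contra hlt
    exact absurd (h2.trans_le (monotone_arrivalTime hi (Nat.succ_le_of_lt (not_le.1 hlt))))
      (not_lt.2 hk)
  rw [arrivalCount, this, csSup_Iic]

theorem exists_arrivalTime_le_lt {i : ℕ → ℝ} (hub : ∀ t, ∃ n, t < arrivalTime i n)
    {t : ℝ} (ht : 0 ≤ t) : ∃ n, arrivalTime i n ≤ t ∧ t < arrivalTime i (n + 1) := by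
  classical
  have hpos : Nat.find (hub t) ≠ 0 := fun h => by
    have := Nat.find_spec (hub t)
    rw [h] at this
    simp only [arrivalTime, Finset.range_zero, Finset.sum_empty] at this
    exact absurd this (not_lt.2 ht)
  obtain ⟨n, hn⟩ := Nat.exists_eq_succ_of_ne_zero hpos
  refine ⟨n, not_lt.1 (Nat.find_min (hub t) (by omega)), ?_⟩
  have := Nat.find_spec (hub t)
  rwa [hn] at this

/-- Before the first arrival the workload just drains. -/
theorem workload_of_lt {i : ℕ → ℝ} (hi : ∀ n, 0 ≤ i n) (s : ℕ → ℝ) (x : ℝ) {t : ℝ} (ht : 0 ≤ t)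
    (h : t < i 0) : workload i s x t = max (x - t) 0 := by
  have : arrivalCount i t = 0 :=
    arrivalCount_eq hi (by simpa [arrivalTime] using ht) (by simpa [arrivalTime] using h)
  simp [workload, this, arrivalTime, workloadAtArrival]

/-- After the first arrival the workload restarts from its value at that arrival. -/
theorem workload_of_le {i : ℕ → ℝ} (hi : ∀ n, 0 ≤ i n) (hub : ∀ t, ∃ n, t < arrivalTime i n)
    (s : ℕ → ℝ) (x : ℝ) {t : ℝ} (h : i 0 ≤ t) :
    workload i s x t = workload (fun k => i (k + 1)) (fun k => s (k + 1))
      (min (max (x - i 0) 0 + s 0) 1) (t - i 0) := by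
  obtain ⟨m, hm1, hm2⟩ := exists_arrivalTime_le_lt hub ((hi 0).trans h)
  obtain ⟨n, rfl⟩ : ∃ n, m = n + 1 := by
    refine Nat.exists_eq_succ_of_ne_zero fun h0 => ?_
    subst h0
    simp only [arrivalTime, zero_add, Finset.sum_range_one] at hm2
    linarith
  have hc := arrivalCount_eq hi hm1 hm2
  rw [arrivalTime_succ_eq] at hm1 hm2
  have hc' : arrivalCount (fun k => i (k + 1)) (t - i 0) = n :=
    arrivalCount_eq (fun k => hi _) (by linarith) (by linarith)
  rw [workload, workload, hc, hc', workloadAtArrival_succ_eq, arrivalTime_succ_eq]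
  congr 1
  ring

theorem workloadAtArrival_le_one (i s : ℕ → ℝ) {x : ℝ} (hx : x ≤ 1) (n : ℕ) :
    workloadAtArrival i s x n ≤ 1 := by
  cases n with
  | zero => exact hx
  | succ n => exact min_le_right _ _

/-- An inter-arrival time of at least `1` empties the system, so the initial state is forgotten. -/
theorem workloadAtArrival_eq_of_one_le (i s : ℕ → ℝ) {x y : ℝ} (hx : x ≤ 1) (hy : y ≤ 1) {k n : ℕ}
    (hk : 1 ≤ i k) (hn : k < n) : workloadAtArrival i s x n = workloadAtArrival i s y n := by
  induction n, hn using Nat.le_induction with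
  | base =>
    have h1 := workloadAtArrival_le_one i s hx k
    have h2 := workloadAtArrival_le_one i s hy k
    simp only [workloadAtArrival]
    rw [max_eq_right (by linarith), max_eq_right (by linarith)]
  | succ n _ ih => simp only [workloadAtArrival, ih]

/-- Once the arrival that closes the long gap has occurred, the current arrival index exceeds `k`,
so both paths have already merged. -/
theorem workload_eq_of_one_le {i : ℕ → ℝ} (hi : ∀ n, 0 ≤ i n)
    (hub : ∀ t, ∃ n, t < arrivalTime i n) (s : ℕ → ℝ) {x y t : ℝ} (hx : x ≤ 1) (hy : y ≤ 1)
    {k : ℕ} (hk : 1 ≤ i k) (ht : arrivalTime i (k + 1) ≤ t) :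
    workload i s x t = workload i s y t := by
  have h0 : (0 : ℝ) ≤ t := le_trans
    (by simpa [arrivalTime] using monotone_arrivalTime hi (Nat.zero_le (k + 1))) ht
  obtain ⟨n, h1, h2⟩ := exists_arrivalTime_le_lt hub h0
  have hkn : k < n := by
    by_contra hlt
    exact absurd (h2.trans_le (monotone_arrivalTime hi (by omega : n + 1 ≤ k + 1)))
      (not_lt.2 ht)
  rw [workload, workload, arrivalCount_eq hi h1 h2, workloadAtArrival_eq_of_one_le i s hx hy hk hkn]

/-! ### Measurability of the workload -/

/-- On `ℕ` the supremum of an empty or unbounded set is `0`. These default cases form the second set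
of the decomposition, which makes `arrivalCount` measurable on all paths, including exceptional ones
with infinitely many arrivals by time `t`. -/
theorem measurable_nat_sSup {α : Type*} [MeasurableSpace α] {E : ℕ → Set α}
    (hE : ∀ n, MeasurableSet (E n)) : Measurable fun a => sSup {n | a ∈ E n} := by
  refine measurable_to_countable' fun m => ?_
  have : (fun a => sSup {n | a ∈ E n}) ⁻¹' {m} =
      {a | a ∈ E m ∧ ∀ k, a ∈ E k → k ≤ m} ∪
        {a | m = 0 ∧ ((∀ M, ∃ k, a ∈ E k ∧ M < k) ∨ ∀ k, a ∉ E k)} := by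
    ext a
    simp only [mem_preimage, mem_singleton_iff, mem_union, mem_ofPred_eq]
    rcases eq_empty_or_nonempty {n | a ∈ E n} with he | hne
    · have h' : ∀ k, a ∉ E k := fun k hk => by
        have : k ∈ {n | a ∈ E n} := hk
        simp [he] at this
      rw [he]
      simp [h', eq_comm]
    · obtain ⟨j, hj⟩ := hne
      by_cases hb : BddAbove {n | a ∈ E n}
      · have hmem : a ∈ E (sSup {n | a ∈ E n}) := Nat.sSup_mem ⟨j, hj⟩ hb
        have hle : ∀ k, a ∈ E k → k ≤ sSup {n | a ∈ E n} := fun k hk => le_csSup hb hk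
        constructor
        · rintro rfl
          exact Or.inl ⟨hmem, hle⟩
        · rintro (⟨h1, h2⟩ | ⟨-, h | h⟩)
          · exact le_antisymm (h2 _ hmem) (hle _ h1)
          · obtain ⟨k, hk, hlt⟩ := h (sSup {n | a ∈ E n})
            exact absurd (hle k hk) (not_le.2 hlt)
          · exact absurd hj (h j)
      · rw [show sSup {n | a ∈ E n} = 0 from csSup_of_not_bddAbove hb |>.trans (by simp)]
        rw [not_bddAbove_iff] at hb
        constructor
        · rintro rfl
          exact Or.inr ⟨rfl, Or.inl hb⟩
        · rintro (⟨_, h2⟩ | ⟨h, -⟩)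
          · obtain ⟨k, hk, hlt⟩ := hb m
            exact absurd (h2 k hk) (not_le.2 hlt)
          · exact h.symm
  rw [this]
  have hEn : ∀ n, Measurable fun a => a ∈ E n := fun n => measurableSet_setOfPred.1 (hE n)
  refine MeasurableSet.union (measurableSet_setOfPred.2 ?_) (measurableSet_setOfPred.2 ?_)
  · exact (hEn m).and (Measurable.forall fun k => (hEn k).imp measurable_const)
  · exact measurable_const.and
      ((Measurable.forall fun M => Measurable.exists fun k => (hEn k).and measurable_const).or
        (Measurable.forall fun k => (hEn k).not))

section measurability

variable {α : Type*} [MeasurableSpace α] {i s : ℕ → α → ℝ} {x t : α → ℝ}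

theorem measurable_arrivalTime (hi : ∀ n, Measurable (i n)) (n : ℕ) :
    Measurable fun a => arrivalTime (fun k => i k a) n :=
  Finset.measurable_fun_sum _ fun k _ => hi k

theorem measurable_workloadAtArrival (hi : ∀ n, Measurable (i n)) (hs : ∀ n, Measurable (s n))
    (hx : Measurable x) (n : ℕ) :
    Measurable fun a => workloadAtArrival (fun k => i k a) (fun k => s k a) (x a) n := by
  induction n with
  | zero => exact hx
  | succ n ih => exact ((((ih.sub (hi n)).max measurable_const).add (hs n)).min measurable_const)

theorem measurable_arrivalCount (hi : ∀ n, Measurable (i n)) (ht : Measurable t) :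
    Measurable fun a => arrivalCount (fun k => i k a) (t a) :=
  measurable_nat_sSup (E := fun n => {a | arrivalTime (fun k => i k a) n ≤ t a})
    fun n => measurableSet_le (measurable_arrivalTime hi n) ht

theorem measurable_workload (hi : ∀ n, Measurable (i n)) (hs : ∀ n, Measurable (s n))
    (hx : Measurable x) (ht : Measurable t) :
    Measurable fun a => workload (fun k => i k a) (fun k => s k a) (x a) (t a) := by
  -- The random arrival index is handled by joint measurability in (path, index), where the index
  -- ranges over a countable set.
  have hF : Measurable fun p : α × ℕ =>
      max (workloadAtArrival (fun k => i k p.1) (fun k => s k p.1) (x p.1) p.2 -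
        (t p.1 - arrivalTime (fun k => i k p.1) p.2)) 0 :=
    measurable_from_prod_countable_left fun n =>
      ((measurable_workloadAtArrival hi hs hx n).sub
        (ht.sub (measurable_arrivalTime hi n))).max measurable_const
  exact hF.comp (measurable_id.prodMk (measurable_arrivalCount hi ht))

end measurability

/-! ### The exponential distribution -/

theorem expMeasure_eq_withDensity (lam : ℝ) :
    expMeasure lam = volume.withDensity (exponentialPDF lam) := rfl

theorem measurable_exponentialPDF (lam : ℝ) : Measurable (exponentialPDF lam) :=
  (measurable_exponentialPDFReal lam).ennreal_ofReal

theorem expMeasure_Iio_zero (lam : ℝ) : expMeasure lam (Iio 0) = 0 := by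
  rw [expMeasure_eq_withDensity, withDensity_apply _ measurableSet_Iio]
  exact lintegral_exponentialPDF_of_nonpos le_rfl

theorem expMeasure_Ioi {lam : ℝ} (hlam : 0 < lam) {t : ℝ} (ht : 0 ≤ t) :
    expMeasure lam (Ioi t) = ENNReal.ofReal (Real.exp (-(lam * t))) := by
  have := isProbabilityMeasure_expMeasure hlam
  have h1 : Real.exp (-(lam * t)) ≤ 1 := Real.exp_le_one_iff.2 (by nlinarith)
  rw [← compl_Iic, prob_compl_eq_one_sub measurableSet_Iic, ← ofReal_cdf, cdf_expMeasure_eq hlam,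
    if_pos ht, ← ENNReal.ofReal_one, ← ENNReal.ofReal_sub _ (by linarith)]
  congr 1
  ring

theorem setLIntegral_Iic_expMeasure (lam t : ℝ) {g : ℝ → ℝ≥0∞} (hg : Measurable g) :
    ∫⁻ s in Iic t, g s ∂expMeasure lam =
      ∫⁻ s in Ioc 0 t, ENNReal.ofReal (lam * Real.exp (-(lam * s))) * g s := by
  rw [expMeasure_eq_withDensity, restrict_withDensity measurableSet_Iic,
    lintegral_withDensity_eq_lintegral_mul _ (measurable_exponentialPDF lam) hg,
    ← setLIntegral_congr (μ := volume) (Ioo_ae_eq_Ioc (a := (0 : ℝ)) (b := t)),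
    setLIntegral_congr (μ := volume) (Iio_ae_eq_Iic (a := t)).symm,
    ← lintegral_indicator measurableSet_Iio, ← lintegral_indicator measurableSet_Ioo]
  refine lintegral_congr_ae ?_
  filter_upwards [Measure.ae_ne volume (0 : ℝ)] with s hs
  by_cases hst : s < t
  · rcases lt_or_gt_of_ne hs with h | h
    · simp [indicator, hst, not_lt.2 h.le, exponentialPDF_of_neg h]
    · simp [indicator, hst, h, exponentialPDF_of_nonneg h.le]
  · simp [indicator, hst]

section input

variable {Ω : Type*} [MeasurableSpace Ω] {P : Measure Ω} {lam : ℝ} {G : Measure ℝ}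
  {I S : ℕ → Ω → ℝ}

/-! ### Almost sure properties of the arrivals -/

theorem IsInput.ae_nonneg (h : IsInput P lam G I S) : ∀ᵐ ω ∂P, ∀ n, 0 ≤ I n ω := by
  refine ae_all_iff.2 fun n => ?_
  have := expMeasure_Iio_zero lam
  rw [← h.law_I n, Measure.map_apply (h.measurable_I n) measurableSet_Iio] at this
  filter_upwards [measure_eq_zero_iff_ae_notMem.1 this] with ω hω
  simpa using hω

theorem IsInput.iIndepFun_I (h : IsInput P lam G I S) : iIndepFun I P :=
  h.indep.precomp (g := Sum.inl) Sum.inl_injective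

/-- Second Borel–Cantelli lemma: the events are independent, each of probability `e^{-λ} > 0`. This
serves both non-explosion and the loss of memory. -/
theorem IsInput.ae_frequently_one_lt (hlam : 0 < lam) (h : IsInput P lam G I S) :
    ∀ᵐ ω ∂P, ∃ᶠ n in atTop, 1 < I n ω := by
  have := h.indep.isProbabilityMeasure
  have hm : ∀ n, MeasurableSet (I n ⁻¹' Ioi 1) := fun n => h.measurable_I n measurableSet_Ioi
  have hind : iIndepSet (fun n => I n ⁻¹' Ioi 1) P := by
    rw [iIndepSet_iff_meas_biInter hm]
    exact fun s => h.iIndepFun_I.meas_biInter fun n _ => ⟨Ioi 1, measurableSet_Ioi, rfl⟩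
  have hsum : ∑' n, P (I n ⁻¹' Ioi 1) = ∞ := by
    have : ∀ n, P (I n ⁻¹' Ioi 1) = ENNReal.ofReal (Real.exp (-(lam * 1))) := fun n => by
      rw [← Measure.map_apply (h.measurable_I n) measurableSet_Ioi, h.law_I,
        expMeasure_Ioi hlam zero_le_one]
    simp_rw [this]
    exact ENNReal.tsum_const_eq_top_of_ne_zero (by simp [Real.exp_pos])
  have h1 := measure_limsup_eq_one hm hind hsum
  have h2 := (prob_compl_eq_zero_iff (MeasurableSet.measurableSet_limsup hm)).2 h1
  filter_upwards [measure_eq_zero_iff_ae_notMem.1 h2] with ω hω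
  rw [notMem_compl_iff, mem_limsup_iff_frequently_mem] at hω
  exact hω

/-- Each gap longer than `1` raises the arrival times by more than `1`, and there are infinitely
many of them. -/
theorem exists_lt_arrivalTime {i : ℕ → ℝ} (hi : ∀ n, 0 ≤ i n) (hf : ∃ᶠ n in atTop, 1 < i n)
    (t : ℝ) : ∃ n, t < arrivalTime i n := by
  have key : ∀ m : ℕ, ∃ n, (m : ℝ) ≤ arrivalTime i n := by
    intro m
    induction m with
    | zero => exact ⟨0, by simp [arrivalTime]⟩
    | succ m ih =>
      obtain ⟨n, hn⟩ := ih
      obtain ⟨k, hk, hik⟩ := frequently_atTop.1 hf n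
      refine ⟨k + 1, ?_⟩
      have := monotone_arrivalTime hi hk
      have hs : arrivalTime i (k + 1) = arrivalTime i k + i k := Finset.sum_range_succ _ _
      push_cast
      linarith
  obtain ⟨m, hm⟩ := exists_nat_gt t
  obtain ⟨n, hn⟩ := key m
  exact ⟨n, hm.trans_le hn⟩

theorem IsInput.ae_exists_lt_arrivalTime (hlam : 0 < lam) (h : IsInput P lam G I S) :
    ∀ᵐ ω ∂P, ∀ t, ∃ n, t < arrivalTime (fun k => I k ω) n := by
  filter_upwards [h.ae_nonneg, h.ae_frequently_one_lt hlam] with ω h1 h2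
  exact exists_lt_arrivalTime h1 h2

/-! ### The renewal equation of the transition probabilities -/

/-- Disjoint blocks of an independent family generate independent σ-algebras. With
`IsInput.map_tail` this is regeneration: after the first arrival the remaining input is an
independent fresh copy. -/
theorem IsInput.indepFun_head_tail (h : IsInput P lam G I S) :
    IndepFun (fun ω => (I 0 ω, S 0 ω))
      (fun ω (j : ℕ ⊕ ℕ) => Sum.elim I S (Sum.map Nat.succ Nat.succ j) ω) P := by
  have hm : ∀ j, Measurable (Sum.elim I S j) := by
    rintro (n | n)
    · exact h.measurable_I n
    · exact h.measurable_S n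
  have hd : Disjoint ({Sum.inl 0, Sum.inr 0} : Set (ℕ ⊕ ℕ))
      (range (Sum.map Nat.succ Nat.succ)) := by
    rw [Set.disjoint_left]
    rintro _ (rfl | rfl) ⟨j | j, hj⟩ <;> simp at hj
  have hi := indep_iSup_of_disjoint (fun j => (hm j).comap_le) h.indep hd
  have hle : ∀ (A : Set (ℕ ⊕ ℕ)) (j : ℕ ⊕ ℕ), j ∈ A →
      Measurable[⨆ k ∈ A, MeasurableSpace.comap (Sum.elim I S k) inferInstance]
        (Sum.elim I S j) := fun A j hj =>
    (comap_measurable (Sum.elim I S j)).mono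
      (le_iSup₂ (f := fun k (_ : k ∈ A) => MeasurableSpace.comap (Sum.elim I S k) inferInstance)
        j hj) le_rfl
  rw [IndepFun_iff_Indep]
  refine indep_of_indep_of_le_left (indep_of_indep_of_le_right hi ?_) ?_
  · exact Measurable.comap_le ((@measurable_pi_iff _ _ _ (_) _ _).2 fun j =>
      hle _ _ (mem_range_self j))
  · exact Measurable.comap_le ((hle _ (Sum.inl 0) (by simp)).prodMk (hle _ (Sum.inr 0) (by simp)))

/-- By independence both laws are infinite products, and their marginals coincide. -/
theorem IsInput.map_tail (h : IsInput P lam G I S) :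
    P.map (fun ω (j : ℕ ⊕ ℕ) => Sum.elim I S (Sum.map Nat.succ Nat.succ j) ω) =
      P.map (fun ω (j : ℕ ⊕ ℕ) => Sum.elim I S j ω) := by
  have hm : ∀ j, Measurable (Sum.elim I S j) := by
    rintro (n | n)
    · exact h.measurable_I n
    · exact h.measurable_S n
  have hinj : Function.Injective (Sum.map Nat.succ Nat.succ) :=
    Nat.succ_injective.sumMap Nat.succ_injective
  rw [h.indep.map_fun_eq_infinitePi_map hm,
    (h.indep.precomp hinj).map_fun_eq_infinitePi_map fun j => hm _]
  congr 1
  ext1 (n | n)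
  · exact (h.law_I _).trans (h.law_I _).symm
  · exact (h.law_S _).trans (h.law_S _).symm

theorem IsInput.map_head (h : IsInput P lam G I S) :
    P.map (fun ω => (I 0 ω, S 0 ω)) = (expMeasure lam).prod G := by
  have := h.indep.isProbabilityMeasure
  rw [← h.law_I 0, ← h.law_S 0]
  exact (indepFun_iff_map_prod_eq_prod_map_map (h.measurable_I 0).aemeasurable
    (h.measurable_S 0).aemeasurable).1
      (h.indep.indepFun (i := Sum.inl 0) (j := Sum.inr 0) (by simp))

theorem IsInput.measurable_transition_comp (h : IsInput P lam G I S) {A : Set ℝ}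
    (hA : MeasurableSet A) {β : Type*} [MeasurableSpace β] {t x : β → ℝ} (ht : Measurable t)
    (hx : Measurable x) : Measurable fun b => transition P I S (t b) (x b) A := by
  have := h.indep.isProbabilityMeasure
  have hI : ∀ n, Measurable fun p : β × Ω => I n p.2 := fun n =>
    (h.measurable_I n).comp measurable_snd
  have hS : ∀ n, Measurable fun p : β × Ω => S n p.2 := fun n =>
    (h.measurable_S n).comp measurable_snd
  have hw : Measurable fun p : β × Ω =>
      workload (fun n => I n p.2) (fun n => S n p.2) (x p.1) (t p.1) :=
    measurable_workload hI hS (hx.comp measurable_fst) (ht.comp measurable_fst)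
  exact measurable_measure_prodMk_left (ν := P) (hw hA)

/-- Decomposition of the transition probabilities at the first arrival. -/
theorem IsInput.transition_eq (hlam : 0 < lam) (h : IsInput P lam G I S) {A : Set ℝ}
    (hA : MeasurableSet A) {t : ℝ} (ht : 0 ≤ t) (x : ℝ) :
    transition P I S t x A =
      ENNReal.ofReal (Real.exp (-(lam * t))) * A.indicator 1 (max (x - t) 0) +
      ∫⁻ s in Ioc 0 t, ENNReal.ofReal (lam * Real.exp (-(lam * s))) *
        ∫⁻ y, transition P I S (t - s) (min (max (x - s) 0 + y) 1) A ∂G := by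
  have := h.indep.isProbabilityMeasure
  have := isProbabilityMeasure_expMeasure hlam
  have : IsProbabilityMeasure G := by
    rw [← h.law_S 0]
    exact Measure.isProbabilityMeasure_map (h.measurable_S 0).aemeasurable
  have hm : ∀ j, Measurable (Sum.elim I S j) := by
    rintro (n | n)
    · exact h.measurable_I n
    · exact h.measurable_S n
  set X : Ω → ℕ ⊕ ℕ → ℝ := fun ω j => Sum.elim I S j ω
  set X' : Ω → ℕ ⊕ ℕ → ℝ := fun ω j => Sum.elim I S (Sum.map Nat.succ Nat.succ j) ω
  have hXm : Measurable X := measurable_pi_iff.2 hm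
  have hXm' : Measurable X' := measurable_pi_iff.2 fun j => hm _
  have hHm : Measurable fun ω => (I 0 ω, S 0 ω) := (h.measurable_I 0).prodMk (h.measurable_S 0)
  have hjoint : P.map (fun ω => ((I 0 ω, S 0 ω), X' ω)) =
      ((expMeasure lam).prod G).prod (P.map X) := by
    rw [(indepFun_iff_map_prod_eq_prod_map_map hHm.aemeasurable hXm'.aemeasurable).1
      h.indepFun_head_tail, h.map_head, h.map_tail]
  -- The event "first arrival by time `t`, and the restarted workload ends in `A`", written on the
  -- space of (first gap, first service, remaining input), where the joint law is a product.
  let B : Set ((ℝ × ℝ) × (ℕ ⊕ ℕ → ℝ)) := {p | p.1.1 ≤ t ∧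
    workload (fun n => p.2 (Sum.inl n)) (fun n => p.2 (Sum.inr n))
      (min (max (x - p.1.1) 0 + p.1.2) 1) (t - p.1.1) ∈ A}
  have hB : MeasurableSet B := by
    refine (measurableSet_le measurable_fst.fst measurable_const).inter ?_
    exact measurable_workload (α := (ℝ × ℝ) × (ℕ ⊕ ℕ → ℝ))
      (i := fun n p => p.2 (Sum.inl n)) (s := fun n p => p.2 (Sum.inr n))
      (x := fun p => min (max (x - p.1.1) 0 + p.1.2) 1) (t := fun p => t - p.1.1)
      (by fun_prop) (by fun_prop) (by fun_prop) (by fun_prop) hA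
  -- This holds only up to a null set: the path identities need nonnegative gaps and non-explosion.
  have hsplit : transition P I S t x A =
      P ({ω | max (x - t) 0 ∈ A} ∩ I 0 ⁻¹' Ioi t) +
        P ((fun ω => ((I 0 ω, S 0 ω), X' ω)) ⁻¹' B) := by
    rw [← measure_union _ ((hHm.prodMk hXm') hB)]
    · refine measure_congr ?_
      filter_upwards [h.ae_nonneg, h.ae_exists_lt_arrivalTime hlam] with ω h0 hub
      refine propext ?_
      change (workload (fun n => I n ω) (fun n => S n ω) x t ∈ A) ↔
        (max (x - t) 0 ∈ A ∧ t < I 0 ω) ∨ (I 0 ω ≤ t ∧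
          workload (fun n => I (n + 1) ω) (fun n => S (n + 1) ω)
            (min (max (x - I 0 ω) 0 + S 0 ω) 1) (t - I 0 ω) ∈ A)
      rcases lt_or_ge t (I 0 ω) with hlt | hle
      · rw [workload_of_lt h0 _ _ ht hlt]
        simp [hlt]
      · rw [workload_of_le h0 hub _ _ hle]
        simp [hle]
    · rw [Set.disjoint_left]
      rintro ω ⟨-, h1⟩ ⟨h2, -⟩
      exact absurd h2 (not_le.2 h1)
  have hp : ∀ s y, P.map X
      {w | workload (fun n => w (Sum.inl n)) (fun n => w (Sum.inr n)) y s ∈ A} =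
      transition P I S s y A := fun s y => by
    rw [Measure.map_apply hXm]
    · rfl
    · exact measurable_workload (α := ℕ ⊕ ℕ → ℝ)
        (i := fun n p => p (Sum.inl n)) (s := fun n p => p (Sum.inr n))
        (x := fun _ => y) (t := fun _ => s)
        (by fun_prop) (by fun_prop) (by fun_prop) (by fun_prop) hA
  rw [hsplit]
  congr 1
  · by_cases hxA : max (x - t) 0 ∈ A
    · simp only [hxA, ofPred_true, univ_inter, indicator_of_mem, Pi.one_apply, mul_one]
      rw [← Measure.map_apply (h.measurable_I 0) measurableSet_Ioi, h.law_I, expMeasure_Ioi hlam ht]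
    · simp [hxA]
  · have hmt : Measurable fun p : ℝ × ℝ =>
        transition P I S (t - p.1) (min (max (x - p.1) 0 + p.2) 1) A :=
      h.measurable_transition_comp hA (by fun_prop) (by fun_prop)
    rw [← Measure.map_apply (hHm.prodMk hXm') hB, hjoint, Measure.prod_apply hB,
      lintegral_prod _ (measurable_measure_prodMk_left hB).aemeasurable,
      ← setLIntegral_Iic_expMeasure _ _ hmt.lintegral_prod_right',
      ← lintegral_indicator measurableSet_Iic]
    refine lintegral_congr fun s => ?_
    by_cases hs : s ≤ t
    · rw [indicator_of_mem (mem_Iic.2 hs)]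
      refine lintegral_congr fun y => ?_
      rw [← hp]
      congr 1
      ext w
      simp [B, hs]
    · rw [indicator_of_notMem (by simpa using hs)]
      simp [B, hs]

/-! ### Uniqueness -/

/-- The workload forgets its initial state, uniformly on `[0, 1]`. -/
theorem IsInput.exists_transition_le (hlam : 0 < lam) (h : IsInput P lam G I S) {ε : ℝ≥0∞}
    (hε : 0 < ε) : ∃ t : ℝ, 0 ≤ t ∧ ∀ x ≤ 1, ∀ y ≤ 1, ∀ A : Set ℝ,
      transition P I S t x A ≤ transition P I S t y A + ε := by
  have := h.indep.isProbabilityMeasure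
  -- `B N` is the event that no gap longer than `1` is over by time `N`. These events decrease to a
  -- null set, and off `B N` all starting points at most `1` give the same workload at time `N`.
  let B : ℕ → Set Ω := fun N =>
    {ω | ∀ k, 1 < I k ω → (N : ℝ) < arrivalTime (fun n => I n ω) (k + 1)}
  have hBm : ∀ N, MeasurableSet (B N) := fun N => by
    refine measurableSet_setOfPred.2 (Measurable.forall fun k => Measurable.imp ?_ ?_)
    · exact measurableSet_setOfPred.1 (measurableSet_lt measurable_const (h.measurable_I k))
    · exact measurableSet_setOfPred.1
        (measurableSet_lt measurable_const (measurable_arrivalTime h.measurable_I _))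
  have hBanti : Antitone B := fun M N hMN ω hω k hk =>
    lt_of_le_of_lt (by exact_mod_cast hMN) (hω k hk)
  have hBzero : P (⋂ N, B N) = 0 := by
    refine measure_eq_zero_iff_ae_notMem.2 ?_
    filter_upwards [h.ae_frequently_one_lt hlam] with ω hω hmem
    obtain ⟨k, hk⟩ := hω.exists
    obtain ⟨N, hN⟩ := exists_nat_gt (arrivalTime (fun n => I n ω) (k + 1))
    exact absurd (mem_iInter.1 hmem N k hk) (not_lt.2 hN.le)
  have hlim := tendsto_measure_iInter_atTop (μ := P) (fun N => (hBm N).nullMeasurableSet) hBanti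
    ⟨0, measure_ne_top _ _⟩
  rw [hBzero] at hlim
  obtain ⟨N, hN⟩ := (hlim.eventually (ge_mem_nhds hε)).exists
  refine ⟨N, N.cast_nonneg, fun x hx y hy A => ?_⟩
  refine le_trans ?_ (add_le_add_right hN _)
  refine le_trans (measure_mono_ae ?_) (measure_union_le _ _)
  filter_upwards [h.ae_nonneg, h.ae_exists_lt_arrivalTime hlam] with ω h0 hub hA
  by_cases hω : ω ∈ B N
  · exact Or.inr hω
  · simp only [B, mem_ofPred_eq, not_forall, not_lt] at hω
    obtain ⟨k, hk, hle⟩ := hω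
    refine Or.inl ?_
    change workload _ _ _ _ ∈ A
    rw [workload_eq_of_one_le h0 hub _ hy hx hk.le hle]
    exact hA

/-- By invariance, each mass of `A` is an average of transition probabilities, which for large `t`
are all within `ε / 2` of the one started in `0`. Exchanging the two measures gives equality. -/
theorem IsInvariantDistribution.le (hlam : 0 < lam) (h : IsInput P lam G I S) {π π' : Measure ℝ}
    (hπ : IsInvariantDistribution P I S π) (hπ' : IsInvariantDistribution P I S π') : π ≤ π' := by
  have := hπ.isProbabilityMeasure
  have := hπ'.isProbabilityMeasure
  refine Measure.le_iff.2 fun A hA => ENNReal.le_of_forall_pos_le_add fun ε hε _ => ?_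
  have hε2 : (0 : ℝ≥0∞) < ε / 2 := by simpa using hε.ne'
  obtain ⟨t, ht, hcoup⟩ := h.exists_transition_le hlam hε2
  have key : ∀ ρ : Measure ℝ, IsInvariantDistribution P I S ρ →
      ρ A ≤ transition P I S t 0 A + ε / 2 ∧ transition P I S t 0 A ≤ ρ A + ε / 2 := by
    intro ρ hρ
    have := hρ.isProbabilityMeasure
    have hae : ∀ᵐ x ∂ρ, x ≤ 1 := by
      filter_upwards [measure_eq_zero_iff_ae_notMem.1 hρ.supported] with x hx
      exact (not_not.1 hx).2
    rw [← hρ.invariant t ht A hA]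
    constructor
    · calc _ ≤ ∫⁻ _, (transition P I S t 0 A + ε / 2) ∂ρ :=
            lintegral_mono_ae (hae.mono fun x hx => hcoup x hx 0 zero_le_one A)
        _ = _ := by simp
    · calc transition P I S t 0 A = ∫⁻ _, transition P I S t 0 A ∂ρ := by simp
        _ ≤ ∫⁻ x, (transition P I S t x A + ε / 2) ∂ρ :=
            lintegral_mono_ae (hae.mono fun x hx => hcoup 0 zero_le_one x hx A)
        _ = _ := by rw [lintegral_add_right _ measurable_const]; simp
  calc π A ≤ transition P I S t 0 A + ε / 2 := (key π hπ).1
    _ ≤ π' A + ε / 2 + ε / 2 := by gcongr; exact (key π' hπ').2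
    _ = π' A + ε := by rw [add_assoc, ENNReal.add_halves]

end input

/-! ### Invariance from the balance equation -/

/-- The substitution `r = t + u - s` at fixed `u` preserves Lebesgue measure, maps the triangle `0 <
u ≤ s ≤ t` to itself and turns `t - s` into `r - u`. -/
theorem lintegral_triangle_shear {φ : ℝ → ℝ → ℝ≥0∞} (hφ : Measurable (Function.uncurry φ))
    (t : ℝ) :
    ∫⁻ s in Ioc 0 t, ∫⁻ u in Ioc 0 s, φ u (t - s) =
      ∫⁻ r in Ioc 0 t, ∫⁻ u in Ioc 0 r, φ u (r - u) := by
  have key : ∀ ψ : ℝ → ℝ → ℝ≥0∞, Measurable (Function.uncurry ψ) →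
      ∫⁻ s in Ioc 0 t, ∫⁻ u in Ioc 0 s, ψ s u =
        ∫⁻ u, ∫⁻ s, {p : ℝ × ℝ | 0 < p.2 ∧ p.2 ≤ p.1 ∧ p.1 ≤ t}.indicator
          (Function.uncurry ψ) (s, u) := by
    intro ψ hψ
    have hT : MeasurableSet {p : ℝ × ℝ | 0 < p.2 ∧ p.2 ≤ p.1 ∧ p.1 ≤ t} :=
      (measurableSet_lt measurable_const measurable_snd).inter
        ((measurableSet_le measurable_snd measurable_fst).inter
          (measurableSet_le measurable_fst measurable_const))
    rw [lintegral_lintegral_swap (f := fun u s =>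
      {p : ℝ × ℝ | 0 < p.2 ∧ p.2 ≤ p.1 ∧ p.1 ≤ t}.indicator (Function.uncurry ψ) (s, u))
      ((hψ.indicator hT).comp measurable_swap).aemeasurable,
      ← lintegral_indicator measurableSet_Ioc]
    refine lintegral_congr fun s => ?_
    by_cases hs : s ∈ Ioc 0 t
    · rw [indicator_of_mem hs, ← lintegral_indicator measurableSet_Ioc]
      refine lintegral_congr fun u => ?_
      simp [indicator, hs.2, Function.uncurry]
    · rw [indicator_of_notMem hs]
      symm
      rw [lintegral_eq_zero_iff' (by
        exact ((hψ.indicator hT).comp measurable_prodMk_left).aemeasurable)]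
      refine Eventually.of_forall fun u => indicator_of_notMem (fun h => hs ?_) _
      exact ⟨h.1.trans_le h.2.1, h.2.2⟩
  rw [key (fun s u => φ u (t - s)) (hφ.comp (by fun_prop : Measurable fun p : ℝ × ℝ =>
      (p.2, t - p.1))), key (fun r u => φ u (r - u)) (hφ.comp (by fun_prop :
      Measurable fun p : ℝ × ℝ => (p.2, p.1 - p.2)))]
  refine lintegral_congr fun u => ?_
  rw [← lintegral_sub_left_eq_self _ (t + u)]
  refine lintegral_congr fun s => ?_
  simp only [indicator, mem_ofPred_eq, Function.uncurry]
  have h1 : (0 < u ∧ u ≤ t + u - s ∧ t + u - s ≤ t) ↔ (0 < u ∧ u ≤ s ∧ s ≤ t) :=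
    ⟨fun h => ⟨h.1, by linarith [h.2.2], by linarith [h.2.1]⟩,
      fun h => ⟨h.1, by linarith [h.2.2], by linarith [h.2.1]⟩⟩
  simp only [h1]
  congr 2
  ring

theorem setLIntegral_Ioc_reflect (g : ℝ → ℝ≥0∞) (t : ℝ) :
    ∫⁻ s in Ioc 0 t, g (t - s) = ∫⁻ s in Ioc 0 t, g s := by
  rw [← setLIntegral_congr (μ := volume) (Ico_ae_eq_Ioc (a := (0 : ℝ)) (b := t)),
    ← lintegral_indicator measurableSet_Ico, ← lintegral_indicator measurableSet_Ioc,
    ← lintegral_sub_left_eq_self _ t]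
  refine lintegral_congr fun s => ?_
  have h1 : t - s ∈ Ico 0 t ↔ s ∈ Ioc 0 t := by
    simp only [mem_Ico, mem_Ioc]
    constructor <;> rintro ⟨h, h'⟩ <;> constructor <;> linarith
  by_cases hs : s ∈ Ioc 0 t
  · rw [indicator_of_mem hs, indicator_of_mem (h1.2 hs), sub_sub_cancel]
  · rw [indicator_of_notMem hs, indicator_of_notMem (mt h1.1 hs)]

theorem ofReal_mul_exp {lam : ℝ} (hlam : 0 ≤ lam) (s : ℝ) :
    ENNReal.ofReal (lam * Real.exp (-(lam * s))) =
      ENNReal.ofReal lam * ENNReal.ofReal (Real.exp (-(lam * s))) := ENNReal.ofReal_mul hlam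

/-- If `p` satisfies the first-arrival equation (with `k` the transition function right after an
arrival) and `ν` satisfies the balance equation, in which `M` is the law right after an arrival of a
queue started in `ν`, then `ν` is invariant for `p`. -/
theorem lintegral_eq_of_renewal_of_balance {lam : ℝ} (hlam : 0 ≤ lam) {ν M : Measure ℝ}
    [IsFiniteMeasure ν] [IsFiniteMeasure M] {f : ℝ → ℝ≥0∞} (hf : Measurable f)
    {p k : ℝ → ℝ → ℝ≥0∞} (hk : Measurable (Function.uncurry k)) (hk1 : ∀ t x, k t x ≤ 1)
    (hp : ∀ t, 0 ≤ t → ∀ x, p t x = ENNReal.ofReal (Real.exp (-(lam * t))) * f (max (x - t) 0) +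
      ∫⁻ s in Ioc 0 t, ENNReal.ofReal (lam * Real.exp (-(lam * s))) * k (t - s) (max (x - s) 0))
    (hpk : ∀ t, ∫⁻ x, p t x ∂M = ∫⁻ x, k t x ∂ν)
    (hbal : ∀ t, 0 ≤ t → ∀ g : ℝ → ℝ≥0∞, Measurable g → ∫⁻ x, g x ∂ν =
      ENNReal.ofReal (Real.exp (-(lam * t))) * ∫⁻ x, g (max (x - t) 0) ∂ν +
      ∫⁻ s in Ioc 0 t, ENNReal.ofReal (lam * Real.exp (-(lam * s))) *
        ∫⁻ x, g (max (x - s) 0) ∂M)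
    {t : ℝ} (ht : 0 ≤ t) : ∫⁻ x, p t x ∂ν = ∫⁻ x, f x ∂ν := by
  set e : ℝ → ℝ≥0∞ := fun s => ENNReal.ofReal (lam * Real.exp (-(lam * s))) with he
  have hem : Measurable e := by fun_prop
  -- the first-arrival equation integrated against a finite measure
  have hint : ∀ (ρ : Measure ℝ) [IsFiniteMeasure ρ] (r : ℝ), 0 ≤ r → ∫⁻ x, p r x ∂ρ =
      ENNReal.ofReal (Real.exp (-(lam * r))) * ∫⁻ x, f (max (x - r) 0) ∂ρ +
      ∫⁻ s in Ioc 0 r, e s * ∫⁻ x, k (r - s) (max (x - s) 0) ∂ρ := by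
    intro ρ _ r hr
    have hm : Measurable fun q : ℝ × ℝ => e q.2 * k (r - q.2) (max (q.1 - q.2) 0) :=
      (hem.comp measurable_snd).mul (hk.comp (by fun_prop :
        Measurable fun q : ℝ × ℝ => (r - q.2, max (q.1 - q.2) 0)))
    simp_rw [hp r hr]
    rw [lintegral_add_left (by fun_prop), lintegral_const_mul _ (by fun_prop),
      lintegral_lintegral_swap (f := fun x s => e s * k (r - s) (max (x - s) 0)) hm.aemeasurable]
    congr 1
    refine lintegral_congr fun s => ?_
    rw [lintegral_const_mul]
    exact hk.comp (by fun_prop : Measurable fun x : ℝ => (r - s, max (x - s) 0))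
  have hD : Measurable (Function.uncurry fun u w => ∫⁻ x, k w (max (x - u) 0) ∂M) :=
    Measurable.lintegral_prod_right' (ν := M)
      (f := fun q : (ℝ × ℝ) × ℝ => k q.1.2 (max (q.2 - q.1.1) 0))
      (hk.comp (by fun_prop : Measurable fun q : (ℝ × ℝ) × ℝ => (q.1.2, max (q.2 - q.1.1) 0)))
  have hkν : Measurable fun s => ∫⁻ x, k s x ∂ν := hk.lintegral_prod_right'
  have ha : Measurable fun s => e s * ∫⁻ x, k (t - s) (max (x - s) 0) ∂ν :=
    hem.mul (Measurable.lintegral_prod_right' (ν := ν)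
      (f := fun q : ℝ × ℝ => k (t - q.1) (max (q.2 - q.1) 0))
      (hk.comp (by fun_prop : Measurable fun q : ℝ × ℝ => (t - q.1, max (q.2 - q.1) 0))))
  have hfM : Measurable fun s => e s * ∫⁻ x, f (max (x - s) 0) ∂M :=
    hem.mul (Measurable.lintegral_prod_right' (ν := M)
      (f := fun q : ℝ × ℝ => f (max (q.2 - q.1) 0)) (by fun_prop))
  -- `a` and `C` are the arrival terms of the first-arrival and balance equations, so the theorem
  -- reduces to `a = C`; `D` is the common two-arrival remainder.
  set C := ∫⁻ s in Ioc 0 t, e s * ∫⁻ x, f (max (x - s) 0) ∂M with hC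
  set a := ∫⁻ s in Ioc 0 t, e s * ∫⁻ x, k (t - s) (max (x - s) 0) ∂ν with ha'
  set D := ∫⁻ s in Ioc 0 t, ∫⁻ u in Ioc 0 s,
    ENNReal.ofReal lam * (e u * ∫⁻ x, k (t - s) (max (x - u) 0) ∂M) with hDdef
  -- Balance over a window of length `s`, applied to `k (t - s)`.
  have hK1 : ∫⁻ s in Ioc 0 t, ENNReal.ofReal lam * ∫⁻ x, k (t - s) x ∂ν = a + D := by
    rw [ha', hDdef, ← lintegral_add_left ha]
    refine setLIntegral_congr_fun measurableSet_Ioc fun s hs => ?_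
    rw [hbal s hs.1.le (k (t - s)) (hk.comp measurable_prodMk_left), mul_add, ← mul_assoc,
      ← ofReal_mul_exp hlam]
    exact congrArg _ (lintegral_const_mul _
      (hem.mul (hD.comp (by fun_prop : Measurable fun u : ℝ => (u, t - s))))).symm
  -- The time-reversed integral: rewrite `ν k_s` as `M p_s`, then use the first-arrival equation
  -- started from `M`.
  have hK2 : ∫⁻ s in Ioc 0 t, ENNReal.ofReal lam * ∫⁻ x, k s x ∂ν = C + D := by
    rw [hC, hDdef, lintegral_triangle_shear
      (φ := fun u w => ENNReal.ofReal lam * (e u * ∫⁻ x, k w (max (x - u) 0) ∂M))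
      (((hem.comp measurable_fst).mul hD).const_mul _), ← lintegral_add_left hfM]
    refine setLIntegral_congr_fun measurableSet_Ioc fun s hs => ?_
    rw [← hpk, hint M s hs.1.le, mul_add, ← mul_assoc, ← ofReal_mul_exp hlam]
    exact congrArg _ (lintegral_const_mul _
      (hem.mul (hD.comp (by fun_prop : Measurable fun u : ℝ => (u, s - u))))).symm
  -- Cancelling `D` in `ℝ≥0∞` requires it to be finite.
  have hfin : C + D ≠ ∞ := by
    rw [← hK2]
    refine ne_top_of_le_ne_top (b := ENNReal.ofReal lam * ν univ * volume (Ioc 0 t)) ?_ ?_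
    · exact ENNReal.mul_ne_top (ENNReal.mul_ne_top ENNReal.ofReal_ne_top (measure_ne_top _ _))
        (by simp)
    · rw [← setLIntegral_const]
      refine lintegral_mono fun s => ?_
      gcongr
      calc _ ≤ ∫⁻ _, 1 ∂ν := lintegral_mono fun x => hk1 s x
        _ = _ := by simp
  have hDfin : D ≠ ∞ := ne_top_of_le_ne_top hfin le_add_self
  have haC : a = C := by
    have := hK1.symm.trans ((setLIntegral_Ioc_reflect
      (fun s => ENNReal.ofReal lam * ∫⁻ x, k s x ∂ν) t).trans hK2)
    exact (ENNReal.add_left_inj hDfin).1 this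
  rw [hint ν t ht, hbal t ht f hf]
  exact congrArg _ haC

/-! ### The balance equation for the stationary measure -/

/-- The stationary distribution up to normalization: a unit atom at `0` and the density
`densitySeries` on `(0, 1]`. -/
noncomputable def stationaryMeasure (lam : ℝ) (G : Measure ℝ) : Measure ℝ :=
  Measure.dirac 0 + (volume.restrict (Ioc 0 1)).withDensity
    fun x => ENNReal.ofReal (densitySeries lam G x)

/-- The law of the workload right after an arrival finding the workload distributed as `ν`. -/
noncomputable def arrivalMeasure (ν G : Measure ℝ) : Measure ℝ :=
  (ν.prod G).map fun q => min (q.1 + q.2) 1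

/-- The density series cut off at the capacity. -/
noncomputable def cutDensity (lam : ℝ) (G : Measure ℝ) : ℝ → ℝ :=
  (Iio 1).indicator (densitySeries lam G)

theorem intervalIntegrable_densitySeries {lam : ℝ} (hlam : 0 ≤ lam) (G : Measure ℝ) (a b : ℝ) :
    IntervalIntegrable (densitySeries lam G) volume a b := by
  have h : ∀ x, IntervalIntegrable (densitySeries lam G) volume 0 x := fun x =>
    intervalIntegrable_of_bounded_on (measurable_densitySeries hlam G)
      fun y hy => norm_densitySeries_le hlam G (abs_le_of_mem_uIoc_zero hy)
  exact (h a).symm.trans (h b)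

theorem intervalIntegrable_cutDensity {lam : ℝ} (hlam : 0 ≤ lam) (G : Measure ℝ) (a b : ℝ) :
    IntervalIntegrable (cutDensity lam G) volume a b := by
  have h := intervalIntegrable_densitySeries hlam G a b
  rw [intervalIntegrable_iff] at h ⊢
  exact h.indicator measurableSet_Iio

theorem cutDensity_nonneg {lam : ℝ} (hlam : 0 ≤ lam) (G : Measure ℝ) {x : ℝ} (hx : 0 ≤ x) :
    0 ≤ cutDensity lam G x := by
  unfold cutDensity indicator
  split_ifs
  · exact densitySeries_nonneg hlam G hx
  · exact le_rfl

theorem integral_cutDensity_eq {lam x : ℝ} (G : Measure ℝ) (hx : x ≤ 1) (hx0 : 0 ≤ x) :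
    ∫ y in (0 : ℝ)..x, cutDensity lam G y = ∫ y in (0 : ℝ)..x, densitySeries lam G y := by
  refine intervalIntegral.integral_congr_ae ?_
  filter_upwards [Measure.ae_ne volume (1 : ℝ)] with y hy hyx
  rw [uIoc_of_le hx0] at hyx
  exact indicator_of_mem (mem_Iio.2 (lt_of_le_of_ne (hyx.2.trans hx) hy)) _

/-- The cut density keeps this valid beyond the capacity, as needed when the balance equation
evaluates at `x + t`. -/
theorem stationaryMeasure_Iic {lam : ℝ} (hlam : 0 ≤ lam) (G : Measure ℝ) {x : ℝ} (hx : 0 ≤ x) :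
    stationaryMeasure lam G (Iic x) =
      ENNReal.ofReal (1 + ∫ y in (0 : ℝ)..x, cutDensity lam G y) := by
  have hnn : ∀ y ∈ Ioc 0 x, 0 ≤ cutDensity lam G y := fun y hy => cutDensity_nonneg hlam G hy.1.le
  rw [stationaryMeasure, Measure.add_apply, Measure.dirac_apply' _ measurableSet_Iic,
    indicator_of_mem (mem_Iic.2 hx), Pi.one_apply, withDensity_apply _ measurableSet_Iic,
    ENNReal.ofReal_add zero_le_one (intervalIntegral.integral_nonneg hx fun y hy =>
      cutDensity_nonneg hlam G hy.1), ENNReal.ofReal_one, intervalIntegral.integral_of_le hx,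
    ofReal_integral_eq_lintegral_ofReal
      ((intervalIntegrable_iff_integrableOn_Ioc_of_le hx).1
        (intervalIntegrable_cutDensity hlam G 0 x))
      ((ae_restrict_iff' measurableSet_Ioc).2 (Eventually.of_forall hnn)),
    Measure.restrict_restrict measurableSet_Iic,
    ← lintegral_indicator (measurableSet_Iic.inter measurableSet_Ioc),
    ← lintegral_indicator measurableSet_Ioc]
  congr 1
  refine lintegral_congr_ae ?_
  filter_upwards [Measure.ae_ne volume (1 : ℝ)] with y hy
  by_cases h : y ∈ Ioc 0 x
  · rw [indicator_of_mem h]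
    rcases lt_or_gt_of_ne hy with h1 | h1
    · rw [indicator_of_mem (show y ∈ Iic x ∩ Ioc 0 1 from ⟨h.2, h.1, h1.le⟩), cutDensity,
        indicator_of_mem (mem_Iio.2 h1)]
    · rw [indicator_of_notMem (fun h' => absurd h'.2.2 (not_le.2 h1)), cutDensity,
        indicator_of_notMem (notMem_Iio.2 h1.le)]
      simp
  · rw [indicator_of_notMem h, indicator_of_notMem fun h' => h ⟨h'.2.1, h'.1⟩]

theorem stationaryMeasure_compl_Icc (lam : ℝ) (G : Measure ℝ) :
    stationaryMeasure lam G (Icc 0 1)ᶜ = 0 := by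
  rw [stationaryMeasure, Measure.add_apply, Measure.dirac_apply' _ measurableSet_Icc.compl,
    withDensity_apply _ measurableSet_Icc.compl,
    Measure.restrict_restrict measurableSet_Icc.compl]
  have : (Icc (0 : ℝ) 1)ᶜ ∩ Ioc 0 1 = ∅ := by
    rw [← disjoint_iff_inter_eq_empty]
    exact disjoint_compl_left.mono_right Ioc_subset_Icc_self
  simp [this]

theorem stationaryMeasure_Iic_of_neg (lam : ℝ) (G : Measure ℝ) {x : ℝ} (hx : x < 0) :
    stationaryMeasure lam G (Iic x) = 0 :=
  measure_mono_null (t := (Icc 0 1)ᶜ) (fun _ hy h => absurd (h.1.trans hy) (not_le.2 hx))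
    (stationaryMeasure_compl_Icc lam G)

theorem stationaryMeasure_univ_eq_Iic (lam : ℝ) (G : Measure ℝ) {x : ℝ} (hx : 1 ≤ x) :
    stationaryMeasure lam G univ = stationaryMeasure lam G (Iic x) := by
  refine le_antisymm ?_ (measure_mono (subset_univ _))
  calc _ ≤ stationaryMeasure lam G (Iic x ∪ (Icc 0 1)ᶜ) := measure_mono fun y _ => by
        by_cases h : y ∈ Icc (0 : ℝ) 1
        · exact Or.inl (h.2.trans hx)
        · exact Or.inr h
    _ ≤ _ := (measure_union_le _ _).trans (by rw [stationaryMeasure_compl_Icc, add_zero])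

theorem stationaryMeasure_univ {lam : ℝ} (hlam : 0 ≤ lam) (G : Measure ℝ) :
    stationaryMeasure lam G univ = ENNReal.ofReal (1 + integralSeries lam G 1) := by
  rw [stationaryMeasure_univ_eq_Iic lam G le_rfl, stationaryMeasure_Iic hlam G zero_le_one,
    integral_cutDensity_eq G le_rfl zero_le_one, integralSeries_eq hlam]

theorem isFiniteMeasure_stationaryMeasure {lam : ℝ} (hlam : 0 ≤ lam) (G : Measure ℝ) :
    IsFiniteMeasure (stationaryMeasure lam G) :=
  ⟨by rw [stationaryMeasure_univ hlam]; exact ENNReal.ofReal_lt_top⟩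

/-- The level crossing equation `u(w) = λ (H(w) - (H * G)(w))` below the capacity. -/
theorem primitive_sub_cutDensity {lam : ℝ} (hlam : 0 < lam) (G : Measure ℝ) {w : ℝ}
    (hw0 : 0 ≤ w) (hw : w < 1) :
    1 + (∫ y in (0 : ℝ)..w, cutDensity lam G y) - cutDensity lam G w / lam =
      cdf G w + ∫ y in (0 : ℝ)..w, densitySeries lam G y * cdf G (w - y) := by
  have hcdf : ∀ z, cdf G z = 1 - tail G z := fun z => by unfold tail; ring
  have hu := intervalIntegrable_densitySeries hlam.le G 0 w
  have hc : IntervalIntegrable (fun y => tail G (w - y) * densitySeries lam G y) volume 0 w := by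
    rw [intervalIntegrable_iff] at hu ⊢
    exact hu.bdd_mul (c := 1)
      ((measurable_tail G).comp (measurable_const.sub measurable_id)).aestronglyMeasurable
      (Eventually.of_forall fun y => abs_tail_le_one G _)
  rw [integral_cutDensity_eq G hw.le hw0, cutDensity, indicator_of_mem (mem_Iio.2 hw),
    densitySeries_eq hlam.le G w]
  simp_rw [hcdf]
  have : ∀ y, densitySeries lam G y * (1 - tail G (w - y)) =
      densitySeries lam G y - tail G (w - y) * densitySeries lam G y := fun y => by ring
  simp_rw [this]
  rw [intervalIntegral.integral_sub hu hc]
  field_simp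
  ring

/-- Ensures that `ENNReal.ofReal` does not truncate when the real identity is transferred to
measures. -/
theorem primitive_sub_cutDensity_nonneg {lam : ℝ} (hlam : 0 < lam) (G : Measure ℝ) {w : ℝ}
    (hw0 : 0 ≤ w) :
    0 ≤ 1 + (∫ y in (0 : ℝ)..w, cutDensity lam G y) - cutDensity lam G w / lam := by
  rcases lt_or_ge w 1 with hw | hw
  · rw [primitive_sub_cutDensity hlam G hw0 hw]
    exact add_nonneg (cdf_nonneg G _) (intervalIntegral.integral_nonneg hw0 fun y hy =>
      mul_nonneg (densitySeries_nonneg hlam.le G hy.1) (cdf_nonneg G _))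
  · have h1 : cutDensity lam G w = 0 := indicator_of_notMem (notMem_Iio.2 hw) _
    have h2 : 0 ≤ ∫ y in (0 : ℝ)..w, cutDensity lam G y :=
      intervalIntegral.integral_nonneg hw0 fun y hy => cutDensity_nonneg hlam.le G hy.1
    rw [h1, zero_div]
    linarith

/-- For `w < 1` truncation is invisible and the mass is `∫ G(w - v) ν(dv)`, the atom contributing
`G(w)`: this is level crossing. For `w ≥ 1` every outcome counts and the cut density is `0`, which
is why the cut excludes the point `1` itself. -/
theorem arrivalMeasure_Iic {lam : ℝ} (hlam : 0 < lam) (G : Measure ℝ)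
    [IsProbabilityMeasure G] (hG : G (Iio 0) = 0) {w : ℝ} (hw0 : 0 ≤ w) :
    arrivalMeasure (stationaryMeasure lam G) G (Iic w) =
      ENNReal.ofReal (1 + (∫ y in (0 : ℝ)..w, cutDensity lam G y) - cutDensity lam G w / lam) := by
  have := isFiniteMeasure_stationaryMeasure hlam.le G
  have hpre : MeasurableSet ((fun q : ℝ × ℝ => min (q.1 + q.2) 1) ⁻¹' Iic w) :=
    (by fun_prop : Measurable fun q : ℝ × ℝ => min (q.1 + q.2) 1) measurableSet_Iic
  rw [arrivalMeasure, Measure.map_apply (by fun_prop) measurableSet_Iic]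
  rcases lt_or_ge w 1 with hw | hw
  · have hsec : ∀ v, Prod.mk v ⁻¹' ((fun q : ℝ × ℝ => min (q.1 + q.2) 1) ⁻¹' Iic w) =
        Iic (w - v) := fun v => by
      ext y
      simp only [mem_preimage, mem_Iic, min_le_iff, not_le.2 hw, or_false]
      exact le_sub_iff_add_le'.symm
    have hm : Measurable fun v => ENNReal.ofReal (cdf G (w - v)) :=
      ((monotone_cdf G).measurable.comp (measurable_const.sub measurable_id)).ennreal_ofReal
    -- Services are almost surely nonnegative, so states above `w` contribute nothing.
    have hneg : ∀ z < 0, ENNReal.ofReal (cdf G z) = 0 := fun z hz => by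
      rw [ofReal_cdf]
      exact measure_mono_null (fun y hy => lt_of_le_of_lt hy hz) hG
    have hu := intervalIntegrable_densitySeries hlam.le G 0 w
    have hint : IntervalIntegrable (fun y => densitySeries lam G y * cdf G (w - y)) volume 0 w := by
      rw [intervalIntegrable_iff] at hu ⊢
      refine hu.mul_bdd (c := 1) ((monotone_cdf G).measurable.comp
        (measurable_const.sub measurable_id)).aestronglyMeasurable
        (Eventually.of_forall fun y => ?_)
      rw [Real.norm_of_nonneg (cdf_nonneg G _)]
      exact cdf_le_one G _
    have hnn : ∀ y, 0 ≤ y → 0 ≤ densitySeries lam G y * cdf G (w - y) := fun y hy =>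
      mul_nonneg (densitySeries_nonneg hlam.le G hy) (cdf_nonneg G _)
    rw [Measure.prod_apply hpre, primitive_sub_cutDensity hlam G hw0 hw,
      ENNReal.ofReal_add (cdf_nonneg G _)
        (intervalIntegral.integral_nonneg hw0 fun y hy => hnn y hy.1),
      intervalIntegral.integral_of_le hw0, ofReal_integral_eq_lintegral_ofReal
        ((intervalIntegrable_iff_integrableOn_Ioc_of_le hw0).1 hint)
        ((ae_restrict_iff' measurableSet_Ioc).2 (Eventually.of_forall fun y hy => hnn y hy.1.le))]
    simp_rw [hsec, ← ofReal_cdf G]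
    rw [stationaryMeasure, lintegral_add_measure, lintegral_dirac' _ hm, sub_zero,
      lintegral_withDensity_eq_lintegral_mul _
        (measurable_densitySeries hlam.le G).ennreal_ofReal hm,
      ← lintegral_indicator measurableSet_Ioc, ← lintegral_indicator measurableSet_Ioc]
    congr 1
    refine lintegral_congr fun y => ?_
    by_cases hy : y ∈ Ioc 0 w
    · rw [indicator_of_mem hy, indicator_of_mem (show y ∈ Ioc 0 1 from ⟨hy.1, hy.2.trans hw.le⟩),
        Pi.mul_apply,
        ENNReal.ofReal_mul (densitySeries_nonneg hlam.le G hy.1.le)]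
    · rw [indicator_of_notMem hy]
      by_cases hy1 : y ∈ Ioc (0 : ℝ) 1
      · have hyw : w < y := by
          by_contra h
          exact hy ⟨hy1.1, not_lt.1 h⟩
        rw [indicator_of_mem hy1, Pi.mul_apply, hneg _ (sub_neg.2 hyw), mul_zero]
      · rw [indicator_of_notMem hy1]
  · have : (fun q : ℝ × ℝ => min (q.1 + q.2) 1) ⁻¹' Iic w = univ :=
      eq_univ_of_forall fun q => (min_le_right _ _).trans hw
    rw [this, ← univ_prod_univ, Measure.prod_prod, measure_univ (μ := G), mul_one,
      stationaryMeasure_univ_eq_Iic lam G hw, stationaryMeasure_Iic hlam.le G hw0, cutDensity,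
      indicator_of_notMem (notMem_Iio.2 hw), zero_div, sub_zero]

/-- Draining for time `s` ends in `Iic x` exactly from `Iic (x + s)`, so this is the balance
equation for distribution functions: `exp_mul_primitive_sub` on `[x, x + t]`, divided by `e^{-λx}`.
-/
theorem stationaryMeasure_balance_Iic {lam : ℝ} (hlam : 0 < lam) (G : Measure ℝ)
    [IsProbabilityMeasure G] (hG : G (Iio 0) = 0) {t x : ℝ} (ht : 0 ≤ t) (hx : 0 ≤ x) :
    stationaryMeasure lam G (Iic x) =
      ENNReal.ofReal (Real.exp (-(lam * t))) * stationaryMeasure lam G (Iic (x + t)) +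
      ∫⁻ s in Ioc 0 t, ENNReal.ofReal (lam * Real.exp (-(lam * s))) *
        arrivalMeasure (stationaryMeasure lam G) G (Iic (x + s)) := by
  set H : ℝ → ℝ := fun w => 1 + ∫ y in (0 : ℝ)..w, cutDensity lam G y with hH
  have hu := intervalIntegrable_cutDensity hlam.le G
  have hHnn : ∀ w, 0 ≤ w → 0 ≤ H w := fun w hw => add_nonneg zero_le_one
    (intervalIntegral.integral_nonneg hw fun y hy => cutDensity_nonneg hlam.le G hy.1)
  have hcont : Continuous H :=
    continuous_const.add (intervalIntegral.continuous_primitive hu 0)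
  have hibp := exp_mul_primitive_sub hu lam 1 x (x + t)
  have hsub := intervalIntegral.integral_comp_add_left (a := 0) (b := t)
    (fun w => Real.exp (-(lam * w)) * (lam * H w - cutDensity lam G w)) x
  have hterm : ∀ s, Real.exp (-(lam * (x + s))) * (lam * H (x + s) - cutDensity lam G (x + s)) =
      Real.exp (-(lam * x)) * (lam * Real.exp (-(lam * s)) *
        (H (x + s) - cutDensity lam G (x + s) / lam)) := fun s => by
    rw [mul_add, neg_add, Real.exp_add]
    field_simp
  have hint : IntervalIntegrable (fun s => lam * Real.exp (-(lam * s)) *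
      (H (x + s) - cutDensity lam G (x + s) / lam)) volume 0 t := by
    have h1 : IntervalIntegrable (fun s => cutDensity lam G (x + s) / lam) volume 0 t := by
      have := (hu x (x + t)).comp_add_left x
      simp only [sub_self, add_sub_cancel_left] at this
      exact this.div_const lam
    have h2 : IntervalIntegrable (fun s => H (x + s)) volume 0 t :=
      (hcont.comp (continuous_const.add continuous_id)).intervalIntegrable _ _
    exact (h2.sub h1).continuousOn_mul (by fun_prop)
  have hnn : ∀ s ∈ Ioc 0 t, 0 ≤ lam * Real.exp (-(lam * s)) *
      (H (x + s) - cutDensity lam G (x + s) / lam) := fun s hs =>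
    mul_nonneg (by positivity) (primitive_sub_cutDensity_nonneg hlam G (add_nonneg hx hs.1.le))
  have hI : 0 ≤ ∫ s in (0 : ℝ)..t, lam * Real.exp (-(lam * s)) *
      (H (x + s) - cutDensity lam G (x + s) / lam) := by
    rw [intervalIntegral.integral_of_le ht]
    exact setIntegral_nonneg measurableSet_Ioc hnn
  have hreal : H x = Real.exp (-(lam * t)) * H (x + t) + ∫ s in (0 : ℝ)..t,
      lam * Real.exp (-(lam * s)) * (H (x + s) - cutDensity lam G (x + s) / lam) := by
    simp_rw [hterm] at hsub
    rw [add_zero, intervalIntegral.integral_const_mul] at hsub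
    have hpos := Real.exp_pos (-(lam * x))
    have he : Real.exp (-(lam * (x + t))) = Real.exp (-(lam * x)) * Real.exp (-(lam * t)) := by
      rw [← Real.exp_add]; congr 1; ring
    have := hsub.trans hibp
    rw [he] at this
    refine mul_left_cancel₀ hpos.ne' ?_
    change _ = Real.exp (-(lam * x)) * H x - _ * H (x + t) at this
    linarith
  rw [stationaryMeasure_Iic hlam.le G hx, stationaryMeasure_Iic hlam.le G (add_nonneg hx ht)]
  change ENNReal.ofReal (H x) = _ * ENNReal.ofReal (H (x + t)) + _
  rw [hreal, ENNReal.ofReal_add (mul_nonneg (Real.exp_pos _).le (hHnn _ (add_nonneg hx ht))) hI,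
    ENNReal.ofReal_mul (Real.exp_pos _).le, intervalIntegral.integral_of_le ht,
    ofReal_integral_eq_lintegral_ofReal
      ((intervalIntegrable_iff_integrableOn_Ioc_of_le ht).1 hint)
      ((ae_restrict_iff' measurableSet_Ioc).2 (Eventually.of_forall hnn))]
  congr 1
  refine setLIntegral_congr_fun measurableSet_Ioc fun s hs => ?_
  rw [arrivalMeasure_Iic hlam G hG (add_nonneg hx hs.1.le), ENNReal.ofReal_mul (by positivity)]

theorem isFiniteMeasure_arrivalMeasure {lam : ℝ} (hlam : 0 < lam) (G : Measure ℝ)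
    [IsProbabilityMeasure G] :
    IsFiniteMeasure (arrivalMeasure (stationaryMeasure lam G) G) := by
  have := isFiniteMeasure_stationaryMeasure hlam.le G
  unfold arrivalMeasure
  infer_instance

/-- The balance equation of the stationary measure over a time interval of length `t`. -/
theorem stationaryMeasure_balance {lam : ℝ} (hlam : 0 < lam) (G : Measure ℝ)
    [IsProbabilityMeasure G] (hG : G (Iio 0) = 0) {t : ℝ} (ht : 0 ≤ t) {g : ℝ → ℝ≥0∞}
    (hg : Measurable g) :
    ∫⁻ x, g x ∂stationaryMeasure lam G =
      ENNReal.ofReal (Real.exp (-(lam * t))) *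
        ∫⁻ x, g (max (x - t) 0) ∂stationaryMeasure lam G +
      ∫⁻ s in Ioc 0 t, ENNReal.ofReal (lam * Real.exp (-(lam * s))) *
        ∫⁻ x, g (max (x - s) 0) ∂arrivalMeasure (stationaryMeasure lam G) G := by
  have := isFiniteMeasure_stationaryMeasure hlam.le G
  have := isFiniteMeasure_arrivalMeasure hlam G
  set ν := stationaryMeasure lam G
  set M := arrivalMeasure ν G
  set R : Measure ℝ := (volume.restrict (Ioc 0 t)).withDensity
    fun s => ENNReal.ofReal (lam * Real.exp (-(lam * s)))
  have hq : Measurable fun x : ℝ => max (x - t) 0 := by fun_prop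
  have hφ : Measurable fun q : ℝ × ℝ => max (q.2 - q.1) 0 := by fun_prop
  have hem : Measurable fun s : ℝ => ENNReal.ofReal (lam * Real.exp (-(lam * s))) := by fun_prop
  -- The right side collects both scenarios into one measure, `R` being the law of the time since
  -- the last arrival, restricted to the window. Finite measures agreeing on all `Iic x` are equal.
  have heq : ν = ENNReal.ofReal (Real.exp (-(lam * t))) • ν.map (fun x => max (x - t) 0) +
      (R.prod M).map fun q => max (q.2 - q.1) 0 := by
    refine Measure.ext_of_Iic _ _ fun x => ?_
    rw [Measure.add_apply, Measure.smul_apply, smul_eq_mul, Measure.map_apply hq measurableSet_Iic,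
      Measure.map_apply hφ measurableSet_Iic]
    rcases lt_or_ge x 0 with hx | hx
    · have h1 : (fun y : ℝ => max (y - t) 0) ⁻¹' Iic x = ∅ :=
        eq_empty_of_forall_notMem fun y hy => absurd ((le_max_right _ _).trans hy) (not_le.2 hx)
      have h2 : (fun q : ℝ × ℝ => max (q.2 - q.1) 0) ⁻¹' Iic x = ∅ :=
        eq_empty_of_forall_notMem fun y hy => absurd ((le_max_right _ _).trans hy) (not_le.2 hx)
      rw [stationaryMeasure_Iic_of_neg lam G hx, h1, h2]
      simp
    · have h1 : ∀ s : ℝ, (fun y : ℝ => max (y - s) 0) ⁻¹' Iic x = Iic (x + s) := fun s => by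
        ext y
        simp [hx]
      have h2 : ∀ s, Prod.mk s ⁻¹' ((fun q : ℝ × ℝ => max (q.2 - q.1) 0) ⁻¹' Iic x) =
          Iic (x + s) := fun s => h1 s
      have h3 : Measurable fun s => M (Iic (x + s)) :=
        Monotone.measurable fun a b hab => measure_mono (Iic_subset_Iic.2 (by linarith))
      rw [Measure.prod_apply (hφ measurableSet_Iic), h1]
      simp_rw [h2]
      rw [lintegral_withDensity_eq_lintegral_mul _ hem h3]
      exact stationaryMeasure_balance_Iic hlam G hG ht hx
  conv_lhs => rw [heq]
  have hgm : Measurable fun s => ∫⁻ x, g (max (x - s) 0) ∂M :=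
    Measurable.lintegral_prod_right' (ν := M)
      (f := fun q : ℝ × ℝ => g (max (q.2 - q.1) 0)) (by fun_prop)
  rw [lintegral_add_measure, lintegral_smul_measure, smul_eq_mul, lintegral_map hg hq,
    lintegral_map hg hφ, lintegral_prod _ (by fun_prop),
    lintegral_withDensity_eq_lintegral_mul _ hem hgm]
  rfl

/-! ### The stationary distribution -/

theorem integralSeries_nonneg {lam : ℝ} (hlam : 0 ≤ lam) (G : Measure ℝ) {x : ℝ} (hx : 0 ≤ x) :
    0 ≤ integralSeries lam G x := by
  rw [integralSeries_eq hlam]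
  exact intervalIntegral.integral_nonneg hx fun y hy => densitySeries_nonneg hlam G hy.1

theorem stationaryMeasure_Icc {lam : ℝ} (hlam : 0 ≤ lam) (G : Measure ℝ) {x : ℝ}
    (hx : x ∈ Icc (0 : ℝ) 1) :
    stationaryMeasure lam G (Icc 0 x) = ENNReal.ofReal (1 + integralSeries lam G x) := by
  rw [integralSeries_eq hlam, ← integral_cutDensity_eq G hx.2 hx.1,
    ← stationaryMeasure_Iic hlam G hx.1]
  refine le_antisymm (measure_mono Icc_subset_Iic_self) ?_
  calc _ ≤ stationaryMeasure lam G (Icc 0 x ∪ (Icc 0 1)ᶜ) := measure_mono fun y hy => by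
        by_cases h : y ∈ Icc (0 : ℝ) 1
        · exact Or.inl ⟨h.1, hy⟩
        · exact Or.inr h
    _ ≤ _ := (measure_union_le _ _).trans (by rw [stationaryMeasure_compl_Icc, add_zero])

theorem stationaryMeasure_restrict_Ioc (lam : ℝ) (G : Measure ℝ) :
    (stationaryMeasure lam G).restrict (Ioc 0 1) = (volume.restrict (Ioc 0 1)).withDensity
      fun x => ENNReal.ofReal (densitySeries lam G x) := by
  rw [stationaryMeasure, Measure.restrict_add, restrict_withDensity measurableSet_Ioc,
    Measure.restrict_restrict measurableSet_Ioc, inter_self,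
    restrict_dirac' measurableSet_Ioc]
  simp

theorem transition_le_one {Ω : Type*} [MeasurableSpace Ω] (P : Measure Ω) [IsProbabilityMeasure P]
    (I S : ℕ → Ω → ℝ) (t x : ℝ) (A : Set ℝ) : transition P I S t x A ≤ 1 := prob_le_one

/-- Here `f` is the indicator of `A` and `k t x` averages the transition probability from `min (x +
y) 1` over a service `y`; its relation to `M` is Fubini. -/
theorem lintegral_transition_stationaryMeasure {Ω : Type*} [MeasurableSpace Ω] {P : Measure Ω}
    [IsProbabilityMeasure P] {lam : ℝ} (hlam : 0 < lam) {G : Measure ℝ} [IsProbabilityMeasure G]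
    (hG : G (Iio 0) = 0) {I S : ℕ → Ω → ℝ} (h : IsInput P lam G I S) {t : ℝ} (ht : 0 ≤ t)
    {A : Set ℝ} (hA : MeasurableSet A) :
    ∫⁻ x, transition P I S t x A ∂stationaryMeasure lam G = stationaryMeasure lam G A := by
  have := isFiniteMeasure_stationaryMeasure hlam.le G
  have := isFiniteMeasure_arrivalMeasure hlam G
  have hk : Measurable (Function.uncurry fun t x =>
      ∫⁻ y, transition P I S t (min (x + y) 1) A ∂G) :=
    Measurable.lintegral_prod_right' (ν := G)
      (f := fun q : (ℝ × ℝ) × ℝ => transition P I S q.1.1 (min (q.1.2 + q.2) 1) A)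
      (h.measurable_transition_comp hA (by fun_prop) (by fun_prop))
  rw [← lintegral_indicator_one hA]
  refine lintegral_eq_of_renewal_of_balance hlam.le
    (M := arrivalMeasure (stationaryMeasure lam G) G) (measurable_one.indicator hA) hk
    (fun t x => ?_) (fun t ht x => h.transition_eq hlam hA ht x)
    (fun t => ?_) (fun t ht g hg => stationaryMeasure_balance hlam G hG ht hg) ht
  · calc _ ≤ ∫⁻ _, 1 ∂G := lintegral_mono fun y => transition_le_one P I S _ _ A
      _ = 1 := by simp
  · have hm : Measurable fun x => transition P I S t x A :=
      h.measurable_transition_comp hA measurable_const measurable_id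
    rw [arrivalMeasure, lintegral_map hm (by fun_prop), lintegral_prod]
    exact (hm.comp (by fun_prop : Measurable fun q : ℝ × ℝ => min (q.1 + q.2) 1)).aemeasurable

end TruncatedQueue

/-! ### Normalization and conclusion -/

open MeasureTheory Set TruncatedQueue in
theorem theorem1 {Ω : Type*} [MeasurableSpace Ω] (P : Measure Ω) [IsProbabilityMeasure P]
    (lam : ℝ) (hlam : 0 < lam)
    (G : Measure ℝ) [IsProbabilityMeasure G] (hG : G (Iio 0) = 0)
    (I S : ℕ → Ω → ℝ) (hinput : IsInput P lam G I S) :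
    -- the two series converge, and so do the integrals in them
    (∀ n : ℕ, IntervalIntegrable (convPow (tail G) n) volume 0 1) ∧
    (∀ x ∈ Icc (0 : ℝ) 1, Summable fun n : ℕ => lam ^ (n + 1) * convPow (tail G) n x) ∧
    (∀ x ∈ Icc (0 : ℝ) 1,
      Summable fun n : ℕ => lam ^ (n + 1) * ∫ y in (0 : ℝ)..x, convPow (tail G) n y) ∧
    -- there is exactly one invariant distribution, and it is given by the formulas
    ∃ π : Measure ℝ, IsInvariantDistribution P I S π ∧
      (∀ π' : Measure ℝ, IsInvariantDistribution P I S π' → π' = π) ∧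
      π.restrict (Ioc 0 1) = (volume.restrict (Ioc 0 1)).withDensity
        (fun x => ENNReal.ofReal (1 / (1 + integralSeries lam G 1) * densitySeries lam G x)) ∧
      (∀ x ∈ Icc (0 : ℝ) 1,
        π.real (Icc 0 x) = (1 + integralSeries lam G x) / (1 + integralSeries lam G 1)) ∧
      0 < π.real {0} ∧ π.real {0} = 1 / (1 + integralSeries lam G 1) := by
  refine ⟨fun n => intervalIntegrable_convPow (measurable_tail G) (abs_tail_le_one G) n 1,
    fun x _ => summable_pow_mul_convPow (abs_tail_le_one G) hlam.le x,
    fun x _ => (hasSum_integralSeries hlam.le G x).summable, ?_⟩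
  set Z := 1 + integralSeries lam G 1 with hZ
  have hZpos : 0 < Z := by
    have := integralSeries_nonneg hlam.le G zero_le_one
    linarith
  have hcdf : ∀ x ∈ Icc (0 : ℝ) 1,
      (ENNReal.ofReal (1 / Z) • stationaryMeasure lam G).real (Icc 0 x) =
        (1 + integralSeries lam G x) / Z := fun x hx => by
    have := integralSeries_nonneg hlam.le G hx.1
    rw [measureReal_def, Measure.smul_apply, stationaryMeasure_Icc hlam.le G hx, smul_eq_mul,
      ENNReal.toReal_mul, ENNReal.toReal_ofReal (by positivity),
      ENNReal.toReal_ofReal (by linarith)]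
    ring
  -- The atom is the distribution function at `0`, as `{0} = Icc 0 0`.
  have hatom : (ENNReal.ofReal (1 / Z) • stationaryMeasure lam G).real {0} = 1 / Z := by
    rw [← Icc_self, hcdf 0 (by simp), integralSeries_eq hlam.le, intervalIntegral.integral_same,
      add_zero]
  have hinv : IsInvariantDistribution P I S
      (ENNReal.ofReal (1 / Z) • stationaryMeasure lam G) := by
    refine ⟨⟨?_⟩, ?_, fun t ht A hA => ?_⟩
    · rw [Measure.smul_apply, stationaryMeasure_univ hlam.le, ← hZ, smul_eq_mul,
        ← ENNReal.ofReal_mul (by positivity), one_div_mul_cancel hZpos.ne', ENNReal.ofReal_one]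
    · rw [Measure.smul_apply, stationaryMeasure_compl_Icc, smul_zero]
    · rw [lintegral_smul_measure, lintegral_transition_stationaryMeasure hlam hG hinput ht hA,
        Measure.smul_apply]
  refine ⟨_, hinv, fun π' hπ' => le_antisymm (hπ'.le hlam hinput hinv) (hinv.le hlam hinput hπ'),
    ?_, hcdf, by rw [hatom]; positivity, hatom⟩
  rw [Measure.restrict_smul, stationaryMeasure_restrict_Ioc,
    ← withDensity_smul _ (measurable_densitySeries hlam.le G).ennreal_ofReal]
  congr 1
  ext1 x
  rw [Pi.smul_apply, smul_eq_mul, ← ENNReal.ofReal_mul (by positivity)]
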